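/- All tournaments are finite. An ordering $\theta=(v_1,\dots,v_n)$ of the vertices of a tournament $T$ has a graph of backward arcs $B(T,\theta)$: the undirected graph on $V(T)$ in which, for $i<j$, the vertices $v_i,v_j$ are adjacent if and only if $(v_j,v_i)$ is an arc of $T$. The boat is the tournament on $\{x,u,v,y\}$ with arcs $(y,x),(y,u),(v,x),(x,u),(u,v),(v,y)$; its path ordering is $(x,u,v,y)$, and the corresponding graph of backward arcs has the edges $yx, yu, vx$. A left boat (resp. right boat) in $B(T,\theta)$ is an induced subgraph on vertices $v_{i_1},v_{i_2},v_{i_3},v_{i_4}$, $i_1<i_2<i_3<i_4$, that under $v_{i_1}\mapsto x$, $v_{i_2}\mapsto u$, $v_{i_3}\mapsto v$, $v_{i_4}\mapsto y$ is the graph of backward arcs of the boat under its path ordering, and such that $i_3=i_2+1=i_1+2$ (resp. $i_4=i_3+1=i_2+2$). A tournament $T$ is a left flotilla (resp. right flotilla) if it has an ordering $\theta$ such that every connected component of $B(T,\theta)$ is a left boat (resp. right boat). A tournament $H$ satisfies the Erdős–Hajnal Conjecture (EHC) if there is $\epsilon>0$ such that every tournament $T$ with $n$ vertices that has no induced subtournament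 isomorphic to $H$ contains a transitive subtournament of size at least $n^{\epsilon}$. **Theorem.** Every left flotilla satisfies EHC, and every right flotilla satisfies EHC. -/

import Mathlib

universe u v

/-- A tournament on the vertex set `V`: a loopless digraph in which every two distinct vertices
are joined by exactly one of the two possible arcs. `T.Adj a b` means that `(a, b)` is an arc. -/
structure Tournament (V : Type u) extends Digraph V where
  loopless : ∀ a : V, ¬ Adj a a
  exactly_one : ∀ a b : V, a ≠ b → Xor (Adj a b) (Adj b a)

namespace Tournament

variable {V : Type u} {W : Type v}

/-- The subtournament `T | X` of `T` induced by a set `X` of vertices. -/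
def induce (T : Tournament V) (X : Set V) : Tournament X where
  Adj a b := T.Adj a b
  loopless a := T.loopless a
  exactly_one a b hab := T.exactly_one a b (fun h => hab (Subtype.ext h))

/-- Two tournaments are isomorphic. -/
def Isomorphic (S : Tournament V) (T : Tournament W) : Prop :=
  ∃ e : V ≃ W, ∀ a b : V, S.Adj a b ↔ T.Adj (e a) (e b)

/-- `T` contains `H`: `H` is isomorphic to `T | X` for some set `X` of vertices of `T`. -/
def Contains (T : Tournament W) (H : Tournament V) : Prop :=
  ∃ X : Set W, H.Isomorphic (T.induce X)

/-- A tournament is transitive if it has no directed cycle, that is, if no vertex can be reached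
from itself along a directed walk of positive length. -/
def IsTransitive (T : Tournament V) : Prop :=
  ∀ a : V, ¬ Relation.TransGen T.Adj a a

/-- `H` satisfies the Erdős–Hajnal conjecture: there is `ε > 0` such that every finite tournament
with `n` vertices that does not contain `H` has a transitive subtournament of size at least
`n ^ ε`. -/
def SatisfiesEHC (H : Tournament V) : Prop :=
  ∃ ε : ℝ, 0 < ε ∧
    ∀ (W : Type v) [Fintype W] (T : Tournament W), ¬ T.Contains H →
      ∃ X : Finset W, (T.induce (X : Set W)).IsTransitive ∧
        (Fintype.card W : ℝ) ^ ε ≤ (X.card : ℝ)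

/-- `(a, b)` is a backward arc of `T` under the ordering `θ = (θ 0, …, θ (n - 1))` of its
vertices. -/
def IsBackwardArc (T : Tournament V) {n : ℕ} (θ : Fin n ≃ V) (a b : V) : Prop :=
  T.Adj a b ∧ θ.symm b < θ.symm a

/-- The graph of backward arcs `B(T, θ)`. -/
def backGraph (T : Tournament V) {n : ℕ} (θ : Fin n ≃ V) : SimpleGraph V where
  Adj a b := T.IsBackwardArc θ a b ∨ T.IsBackwardArc θ b a
  symm := ⟨fun _ _ h => Or.symm h⟩
  loopless := ⟨fun a h => h.elim (fun h' => T.loopless a h'.1) (fun h' => T.loopless a h'.1)⟩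

/-- The boat `{x, u, v, y}`, with `x = 0`, `u = 1`, `v = 2`, `y = 3`. -/
def boat : Tournament (Fin 4) where
  Adj a b := (a, b) = (3, 0) ∨ (a, b) = (3, 1) ∨ (a, b) = (2, 0) ∨
    (a, b) = (0, 1) ∨ (a, b) = (1, 2) ∨ (a, b) = (2, 3)
  loopless := by decide
  exactly_one := by unfold Xor; decide

/-- The path ordering `(x, u, v, y)` of the boat. -/
def boatPathOrdering : Fin 4 ≃ Fin 4 := Equiv.refl (Fin 4)

/-- The vertices of `T` in the positions `i 0 < i 1 < i 2 < i 3` under `θ` induce in `B(T, θ)` the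
graph of backward arcs of a boat under its path ordering. -/
def IsBoatAt (T : Tournament V) {n : ℕ} (θ : Fin n ≃ V) (i : Fin 4 → Fin n) : Prop :=
  StrictMono i ∧ ∀ a b : Fin 4,
    (T.backGraph θ).Adj (θ (i a)) (θ (i b)) ↔ (boat.backGraph boatPathOrdering).Adj a b

/-- A left boat: the first three of the four positions are consecutive. -/
def IsLeftBoat (T : Tournament V) {n : ℕ} (θ : Fin n ≃ V) (i : Fin 4 → Fin n) : Prop :=
  T.IsBoatAt θ i ∧ (i 1 : ℕ) = (i 0 : ℕ) + 1 ∧ (i 2 : ℕ) = (i 1 : ℕ) + 1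

/-- A right boat: the last three of the four positions are consecutive. -/
def IsRightBoat (T : Tournament V) {n : ℕ} (θ : Fin n ≃ V) (i : Fin 4 → Fin n) : Prop :=
  T.IsBoatAt θ i ∧ (i 2 : ℕ) = (i 1 : ℕ) + 1 ∧ (i 3 : ℕ) = (i 2 : ℕ) + 1

/-- `T` is a left flotilla: for some ordering `θ` of its vertices, every connected component of
`B(T, θ)` is a left boat. -/
def IsLeftFlotilla (T : Tournament V) : Prop :=
  ∃ (n : ℕ) (θ : Fin n ≃ V), ∀ C : (T.backGraph θ).ConnectedComponent,
    ∃ i : Fin 4 → Fin n, T.IsLeftBoat θ i ∧ C.supp = Set.range (fun k => θ (i k))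

/-- `T` is a right flotilla: for some ordering `θ` of its vertices, every connected component of
`B(T, θ)` is a right boat. -/
def IsRightFlotilla (T : Tournament V) : Prop :=
  ∃ (n : ℕ) (θ : Fin n ≃ V), ∀ C : (T.backGraph θ).ConnectedComponent,
    ∃ i : Fin 4 → Fin n, T.IsRightBoat θ i ∧ C.supp = Set.range (fun k => θ (i k))

end Tournament

namespace Tournament

variable {V : Type u} {W : Type v} {T : Tournament W}

/-! Take an inclusion-minimal vertex set X violating |X|^ε ≤ tr X (`IsCritical`), with ε tiny, in a
tournament omitting H. Omitting H yields disjoint linear sets S_i in X, one per position of the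
ordering, such that every vertex has few backward neighbours in each set (`exists_smooth_sequence`).
The components of the backward graph can then be embedded greedily. Each new boat avoids the
backward neighbours of the earlier ones, so arcs between boats point forward. In a left boat the
first three positions are consecutive, so x, u, v may share one set without changing the order
relative to other boats (`IsLeftFlotilla.exists_pattern`).

The core is finding one boat with x, u, v in B and y in Y (`IsCritical.exists_boat`). Let N(y) be
the set of out-neighbours of y in B. If there is no boat, no cyclic triangle of B has exactly two
vertices in N(y). Hence the strong components of the N(y) are modules of B and form a laminar
family, and the maximal ones partition B into small modules (`exists_module_partition`). Each N(y)
meets the parts in a transitive pattern, so the values tr M of the parts it meets sum to at most tr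
X. Double counting, with the lower bounds on tr M from minimality, gives a large transitive Z in B
disjoint from N(y) for half of the y in Y. A large transitive set of such y extends Z to one larger
than tr X, a contradiction (`IsCritical.false_of_module_partition`).

Right flotillas reduce to left ones by reversing all arcs, since the backward graph of the boat is
symmetric. -/

theorem Adj.asymm {a b : W} (h : T.Adj a b) : ¬ T.Adj b a := by
  have hab : a ≠ b := by rintro rfl; exact T.loopless _ h
  rcases T.exactly_one a b hab with h' | h'
  · exact h'.2
  · exact absurd h h'.2

theorem adj_of_not_adj {a b : W} (hab : a ≠ b) (h : ¬ T.Adj a b) : T.Adj b a := by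
  rcases T.exactly_one a b hab with h' | h'
  · exact absurd h'.1 h
  · exact h'.1

theorem Adj.ne {a b : W} (h : T.Adj a b) : a ≠ b := by
  rintro rfl; exact T.loopless _ h

/-- The restriction of the arc relation to `Z` is transitive. -/
def TransOn (T : Tournament W) (Z : Finset W) : Prop :=
  ∀ a ∈ Z, ∀ b ∈ Z, ∀ c ∈ Z, T.Adj a b → T.Adj b c → T.Adj a c

theorem TransOn.isTransitive {Z : Finset W} (h : T.TransOn Z) :
    (T.induce (Z : Set W)).IsTransitive := by
  have key : ∀ a b : (Z : Set W), Relation.TransGen (T.induce (Z : Set W)).Adj a b →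
      T.Adj a b := by
    intro a b hab
    induction hab with
    | single h' => exact h'
    | @tail b c _ h' ih =>
      exact h a (Finset.mem_coe.1 a.2) b (Finset.mem_coe.1 b.2) c (Finset.mem_coe.1 c.2) ih h'
  exact fun a ha => T.loopless _ (key a a ha)

open scoped Classical in
/-- The largest size of a transitive subset of `X`. -/
noncomputable def tr (T : Tournament W) (X : Finset W) : ℕ :=
  (X.powerset.filter T.TransOn).sup Finset.card

theorem TransOn.card_le_tr {X Z : Finset W} (h : T.TransOn Z) (hZ : Z ⊆ X) :
    Z.card ≤ T.tr X := by
  classical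
  exact Finset.le_sup (f := Finset.card)
    (Finset.mem_filter.2 ⟨Finset.mem_powerset.2 hZ, h⟩)

theorem exists_transOn_card_eq_tr (T : Tournament W) (X : Finset W) :
    ∃ Z ⊆ X, T.TransOn Z ∧ Z.card = T.tr X := by
  classical
  have hne : (X.powerset.filter T.TransOn).Nonempty :=
    ⟨∅, Finset.mem_filter.2 ⟨Finset.mem_powerset.2 (Finset.empty_subset _),
      fun a ha => absurd ha (Finset.notMem_empty a)⟩⟩
  obtain ⟨Z, hZ, h⟩ := Finset.exists_mem_eq_sup _ hne Finset.card
  rw [Finset.mem_filter, Finset.mem_powerset] at hZ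
  exact ⟨Z, hZ.1, hZ.2, h.symm⟩

/-! ### Strong components of unsplit sets: modules and laminarity -/

/-- `a` and `b` lie in the same strong component of the subtournament induced by `N`. -/
def Linked (T : Tournament W) (N : Finset W) (a b : W) : Prop :=
  a ∈ N ∧ b ∈ N ∧
    Relation.ReflTransGen (fun p q => p ∈ N ∧ q ∈ N ∧ T.Adj p q) a b ∧
    Relation.ReflTransGen (fun p q => p ∈ N ∧ q ∈ N ∧ T.Adj p q) b a

/-- No cyclic triangle in `B` has exactly two vertices in `N`. -/
def Unsplit (T : Tournament W) (B N : Finset W) : Prop :=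
  ∀ a ∈ N, ∀ b ∈ N, ∀ c ∈ B, c ∉ N → T.Adj a b → T.Adj b c → ¬ T.Adj c a

theorem Linked.symm {N : Finset W} {a b : W} (h : T.Linked N a b) : T.Linked N b a :=
  ⟨h.2.1, h.1, h.2.2.2, h.2.2.1⟩

theorem Linked.trans {N : Finset W} {a b c : W} (h : T.Linked N a b) (h' : T.Linked N b c) :
    T.Linked N a c :=
  ⟨h.1, h'.2.1, h.2.2.1.trans h'.2.2.1, h'.2.2.2.trans h.2.2.2⟩

theorem Linked.of_cycle {N : Finset W} {a b c : W} (ha : a ∈ N) (hb : b ∈ N) (hc : c ∈ N)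
    (hab : T.Adj a b) (hbc : T.Adj b c) (hca : T.Adj c a) : T.Linked N a b :=
  ⟨ha, hb, .single ⟨ha, hb, hab⟩, .tail (.single ⟨hb, hc, hbc⟩) ⟨hc, ha, hca⟩⟩

/-- Strong components of an unsplit N are modules of B. For v in N, an arc b → v would put v in the
component. For v outside N, the first reversal along a path from a to b would create a cyclic
triangle with exactly two vertices in N. -/
theorem Linked.adj_of_adj {B N : Finset W} (hN : T.Unsplit B N) {a b v : W}
    (h : T.Linked N a b) (hv : v ∈ B) (hva : ¬ T.Linked N v a) (hadj : T.Adj v a) :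
    T.Adj v b := by
  obtain ⟨ha, hb, hab, hba⟩ := h
  by_cases hvN : v ∈ N
  · by_contra hvb
    have hne : v ≠ b := by
      rintro rfl
      exact hva ⟨hb, ha, hba, hab⟩
    have hbv := adj_of_not_adj hne hvb
    exact hva ⟨hvN, ha, .single ⟨hvN, ha, hadj⟩, hab.tail ⟨hb, hvN, hbv⟩⟩
  · clear hba hva hb
    induction hab with
    | refl => exact hadj
    | tail _ h ih =>
      by_contra hvq
      exact hN _ h.1 _ h.2.1 v hv hvN h.2.2
        (adj_of_not_adj (fun e => hvN (e ▸ h.2.1)) hvq) ih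

theorem Linked.adj_of_adj' {B N : Finset W} (hN : T.Unsplit B N) {a b v : W}
    (h : T.Linked N a b) (hv : v ∈ B) (hva : ¬ T.Linked N v a) (hadj : T.Adj a v) :
    T.Adj b v := by
  have hvb : ¬ T.Linked N v b := fun h' => hva (h'.trans h.symm)
  by_contra hbv
  have hne : b ≠ v := by
    rintro rfl
    exact hva h.symm
  exact Adj.asymm hadj (h.symm.adj_of_adj hN hv hvb (adj_of_not_adj hne hbv))

/-- Half of laminarity. Let C be the component of a in N and C' that of c in N', with b in both. If
a → c, the module property makes every vertex of C outside C' dominate C'. A path from b to a in C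
can then never leave C', so a lies in C'. -/
theorem Linked.not_adj_of_overlap {B N N' : Finset W} (hNB : N ⊆ B) (hNB' : N' ⊆ B)
    (hN : T.Unsplit B N) (hN' : T.Unsplit B N') {a b c : W}
    (hab : T.Linked N a b) (hbc : T.Linked N' b c) (h : ¬ T.Linked N a c)
    (h' : ¬ T.Linked N' a c) : ¬ T.Adj a c := by
  intro hac
  have hcB : c ∈ B := hNB' hbc.2.1
  have hca : ¬ T.Linked N c a := fun h'' => h h''.symm
  have h1 : ∀ z, T.Linked N a z → T.Adj z c := fun z hz => hz.adj_of_adj' hN hcB hca hac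
  have h2 : ∀ z, T.Linked N a z → ¬ T.Linked N' z c → ∀ w, T.Linked N' c w → T.Adj z w :=
    fun z hz hzc w hw => hw.adj_of_adj hN' (hNB hz.2.1) hzc (h1 z hz)
  have h3 : ∀ z, Relation.ReflTransGen (fun p q => p ∈ N ∧ q ∈ N ∧ T.Adj p q) z a →
      T.Linked N a z → T.Linked N' z c → T.Linked N' a c := by
    intro z hz
    induction hz using Relation.ReflTransGen.head_induction_on with
    | refl => exact fun _ h => h
    | @head p q hpq hqa ih =>
      intro hap hpc
      have haq : T.Linked N a q := ⟨hap.1, hpq.2.1, hap.2.2.1.tail hpq, hqa⟩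
      refine ih haq ?_
      by_contra hqc
      exact Adj.asymm hpq.2.2 (h2 q haq hqc p hpc.symm)
  exact h' (h3 b hab.2.2.2 hab hbc)

/-- Intersecting components are nested: if neither contained the other, suitable a and c would have
no arc in either direction. This is what makes `FamLinked` transitive. -/
theorem Linked.linked_or_linked {B N N' : Finset W} (hNB : N ⊆ B) (hNB' : N' ⊆ B)
    (hN : T.Unsplit B N) (hN' : T.Unsplit B N') {a b c : W}
    (hab : T.Linked N a b) (hbc : T.Linked N' b c) :
    T.Linked N a c ∨ T.Linked N' a c := by
  by_contra hcon
  push Not at hcon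
  obtain ⟨h, h'⟩ := hcon
  have hne : a ≠ c := by
    rintro rfl
    exact h (hab.trans hab.symm)
  refine hbc.symm.not_adj_of_overlap hNB' hNB hN' hN hab.symm (fun h'' => h' h''.symm)
    (fun h'' => h h''.symm) (adj_of_not_adj hne ?_)
  exact hab.not_adj_of_overlap hNB hNB' hN hN' hbc h h'

/-- Vertices that are equal or linked in some set of the family `N`. -/
def FamLinked (T : Tournament W) (Y : Finset W) (N : W → Finset W) (a b : W) : Prop :=
  a = b ∨ ∃ y ∈ Y, T.Linked (N y) a b

theorem FamLinked.symm {Y : Finset W} {N : W → Finset W} {a b : W}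
    (h : T.FamLinked Y N a b) : T.FamLinked Y N b a := by
  rcases h with rfl | ⟨y, hy, h⟩
  · exact Or.inl rfl
  · exact Or.inr ⟨y, hy, h.symm⟩

theorem FamLinked.trans {B Y : Finset W} {N : W → Finset W} (hNB : ∀ y ∈ Y, N y ⊆ B)
    (hN : ∀ y ∈ Y, T.Unsplit B (N y)) {a b c : W}
    (h : T.FamLinked Y N a b) (h' : T.FamLinked Y N b c) : T.FamLinked Y N a c := by
  rcases h with rfl | ⟨y, hy, h⟩
  · exact h'
  rcases h' with rfl | ⟨y', hy', h'⟩
  · exact Or.inr ⟨y, hy, h⟩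
  rcases h.linked_or_linked (hNB y hy) (hNB y' hy') (hN y hy) (hN y' hy') h' with h | h
  · exact Or.inr ⟨y, hy, h⟩
  · exact Or.inr ⟨y', hy', h⟩

theorem FamLinked.adj_of_adj {B Y : Finset W} {N : W → Finset W}
    (hN : ∀ y ∈ Y, T.Unsplit B (N y)) {a b v : W} (h : T.FamLinked Y N a b) (hv : v ∈ B)
    (hva : ¬ T.FamLinked Y N v a) (hadj : T.Adj v a) : T.Adj v b := by
  rcases h with rfl | ⟨y, hy, h⟩
  · exact hadj
  · exact h.adj_of_adj (hN y hy) hv (fun h' => hva (Or.inr ⟨y, hy, h'⟩)) hadj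

theorem FamLinked.adj_of_adj' {B Y : Finset W} {N : W → Finset W}
    (hN : ∀ y ∈ Y, T.Unsplit B (N y)) {a b v : W} (h : T.FamLinked Y N a b) (hv : v ∈ B)
    (hva : ¬ T.FamLinked Y N v a) (hadj : T.Adj a v) : T.Adj b v := by
  rcases h with rfl | ⟨y, hy, h⟩
  · exact hadj
  · exact h.adj_of_adj' (hN y hy) hv (fun h' => hva (Or.inr ⟨y, hy, h'⟩)) hadj

open scoped Classical in
/-- The class of a vertex with respect to `FamLinked` has one element or is contained in a single
member of the family. -/
theorem FamLinked.class_subset {B Y : Finset W} {N : W → Finset W} (hNB : ∀ y ∈ Y, N y ⊆ B)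
    (hN : ∀ y ∈ Y, T.Unsplit B (N y)) (b : W) :
    B.filter (T.FamLinked Y N b) ⊆ {b} ∨ ∃ y ∈ Y, B.filter (T.FamLinked Y N b) ⊆ N y := by
  by_cases hb : ∃ y ∈ Y, b ∈ N y
  · right
    obtain ⟨y₀, hy₀, hb₀⟩ := hb
    -- By laminarity the components through b form a chain, so the largest one is the whole class.
    obtain ⟨y, hy, hmax⟩ := Finset.exists_max_image (Y.filter fun y => b ∈ N y)
      (fun y => (B.filter (T.Linked (N y) b)).card) ⟨y₀, Finset.mem_filter.2 ⟨hy₀, hb₀⟩⟩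
    rw [Finset.mem_filter] at hy
    refine ⟨y, hy.1, fun c hc => ?_⟩
    rw [Finset.mem_filter] at hc
    obtain ⟨-, rfl | ⟨y', hy', hbc⟩⟩ := hc
    · exact hy.2
    by_contra hcN
    have hlt : B.filter (T.Linked (N y) b) ⊂ B.filter (T.Linked (N y') b) := by
      refine (Finset.ssubset_iff_of_subset fun a ha => ?_).2
        ⟨c, Finset.mem_filter.2 ⟨hNB y' hy' hbc.2.1, hbc⟩,
          fun h => hcN (Finset.mem_filter.1 h).2.2.1⟩
      rw [Finset.mem_filter] at ha ⊢
      refine ⟨ha.1, ?_⟩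
      rcases ha.2.symm.linked_or_linked (hNB y hy.1) (hNB y' hy') (hN y hy.1) (hN y' hy') hbc
        with h | h
      · exact absurd h.2.1 hcN
      · exact hbc.trans h.symm
    exact absurd (hmax y' (Finset.mem_filter.2 ⟨hy', hbc.1⟩)) (not_le.2 (Finset.card_lt_card hlt))
  · left
    intro c hc
    rw [Finset.mem_filter] at hc
    obtain ⟨-, rfl | ⟨y', hy', hbc⟩⟩ := hc
    · exact Finset.mem_singleton_self _
    · exact absurd ⟨y', hy', hbc.1⟩ hb

open scoped Classical in
/-- A family of sets cut monotonically by the outside vertices induces a partition of `B` into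
modules, each inside a single set of the family, such that each member of the family meets the
parts in a transitive pattern. -/
theorem exists_module_partition {B Y : Finset W} {N : W → Finset W} (hNB : ∀ y ∈ Y, N y ⊆ B)
    (hN : ∀ y ∈ Y, T.Unsplit B (N y)) :
    ∃ P : Finpartition B,
      (∀ M ∈ P.parts, M.card ≤ 1 ∨ ∃ y ∈ Y, M ⊆ N y) ∧
      (∀ M ∈ P.parts, ∀ M' ∈ P.parts, M ≠ M' → ∀ a ∈ M, ∀ a' ∈ M, ∀ b ∈ M', ∀ b' ∈ M',
        T.Adj a b → T.Adj a' b') ∧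
      (∀ y ∈ Y, ∀ a ∈ N y, ∀ b ∈ N y, ∀ c ∈ N y, T.Adj a b → T.Adj b c → T.Adj c a →
        ∃ M ∈ P.parts, a ∈ M ∧ b ∈ M) := by
  set cls : W → Finset W := fun b => B.filter (T.FamLinked Y N b) with hcls
  have hrefl : ∀ a, T.FamLinked Y N a a := fun a => Or.inl rfl
  have hmem : ∀ a ∈ B, a ∈ cls a := fun a ha => Finset.mem_filter.2 ⟨ha, hrefl a⟩
  have heq : ∀ a b, T.FamLinked Y N a b → cls a = cls b := by
    intro a b hab
    ext c
    simp only [hcls, Finset.mem_filter]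
    exact and_congr_right fun _ => ⟨fun h => hab.symm.trans hNB hN h, fun h => hab.trans hNB hN h⟩
  let P : Finpartition B := Finpartition.ofExistsUnique (B.image cls)
    (by
      intro M hM
      obtain ⟨b, -, rfl⟩ := Finset.mem_image.1 hM
      exact Finset.filter_subset _ _)
    (by
      intro a ha
      refine ⟨cls a, ⟨Finset.mem_image_of_mem _ ha, hmem a ha⟩, ?_⟩
      rintro M ⟨hM, haM⟩
      obtain ⟨b, -, rfl⟩ := Finset.mem_image.1 hM
      exact heq _ _ (Finset.mem_filter.1 haM).2)
    (by
      intro h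
      obtain ⟨b, hb, h⟩ := Finset.mem_image.1 h
      exact absurd (hmem b hb) (h ▸ Finset.notMem_empty b))
  have hP : ∀ M, M ∈ P.parts ↔ ∃ b ∈ B, cls b = M := fun M => Finset.mem_image
  refine ⟨P, ?_, ?_, ?_⟩
  · intro M hM
    obtain ⟨b, -, rfl⟩ := (hP M).1 hM
    rcases FamLinked.class_subset hNB hN b with h | h
    · exact Or.inl (by simpa using Finset.card_le_card h)
    · exact Or.inr h
  · intro M hM M' hM' hne a ha a' ha' b hb b' hb' hab
    obtain ⟨r, -, rfl⟩ := (hP M).1 hM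
    obtain ⟨s, -, rfl⟩ := (hP M').1 hM'
    have hsep : ∀ x ∈ cls r, ∀ z ∈ cls s, ¬ T.FamLinked Y N x z := by
      intro x hx z hz hxz
      apply hne
      rw [heq _ _ (Finset.mem_filter.1 hx).2, heq _ _ (Finset.mem_filter.1 hz).2, heq _ _ hxz]
    have haa : T.FamLinked Y N a a' :=
      (Finset.mem_filter.1 ha).2.symm.trans hNB hN (Finset.mem_filter.1 ha').2
    have hbb : T.FamLinked Y N b b' :=
      (Finset.mem_filter.1 hb).2.symm.trans hNB hN (Finset.mem_filter.1 hb').2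
    exact hbb.adj_of_adj hN (Finset.mem_filter.1 ha').1 (hsep a' ha' b hb)
      (haa.adj_of_adj' hN (Finset.mem_filter.1 hb).1 (fun h => hsep a ha b hb h.symm) hab)
  · intro y hy a ha b hb c hc hab hbc hca
    refine ⟨cls a, (hP _).2 ⟨a, hNB y hy ha, rfl⟩, hmem a (hNB y hy ha), ?_⟩
    exact Finset.mem_filter.2 ⟨hNB y hy hb, Or.inr ⟨y, hy, .of_cycle ha hb hc hab hbc hca⟩⟩

/-! ### Combining transitive subsets of modules -/

open scoped Classical in
/-- If a set meets the parts of a partition into modules in a transitive pattern, then largest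
transitive subsets of the parts it meets combine to a transitive set. -/
theorem sum_tr_le_tr {B X : Finset W} (hBX : B ⊆ X) (P : Finpartition B)
    (hP : ∀ M ∈ P.parts, ∀ M' ∈ P.parts, M ≠ M' → ∀ a ∈ M, ∀ a' ∈ M, ∀ b ∈ M', ∀ b' ∈ M',
        T.Adj a b → T.Adj a' b')
    {Z : Finset W}
    (hZ : ∀ a ∈ Z, ∀ b ∈ Z, ∀ c ∈ Z, T.Adj a b → T.Adj b c → T.Adj c a →
        ∃ M ∈ P.parts, a ∈ M ∧ b ∈ M) :
    ∑ M ∈ P.parts.filter (fun M => ¬ Disjoint M Z), T.tr M ≤ T.tr X := by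
  set J := P.parts.filter (fun M => ¬ Disjoint M Z) with hJ
  choose S hS hStr hScard using fun M => T.exists_transOn_card_eq_tr M
  have hJP : ∀ M ∈ J, M ∈ P.parts := fun M hM => (Finset.mem_filter.1 hM).1
  have hrep : ∀ M ∈ J, ∃ r ∈ M, r ∈ Z := fun M hM =>
    Finset.not_disjoint_iff.1 (Finset.mem_filter.1 hM).2
  -- `choose!` needs a default value in W.
  rcases isEmpty_or_nonempty W with hW | hW
  · rw [Finset.sum_eq_zero fun M hM => isEmptyElim (hrep M hM).choose]
    exact Nat.zero_le _
  choose! r hrM hrZ using hrep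
  have hdisj : ∀ M ∈ J, ∀ M' ∈ J, M ≠ M' → Disjoint M M' := fun M hM M' hM' hne =>
    P.disjoint (hJP M hM) (hJP M' hM') hne
  have hcard : (J.biUnion S).card = ∑ M ∈ J, T.tr M := by
    rw [Finset.card_biUnion]
    · exact Finset.sum_congr rfl fun M _ => hScard M
    · exact fun M hM M' hM' hne => (hdisj M hM M' hM' hne).mono (hS M) (hS M')
  rw [← hcard]
  refine TransOn.card_le_tr ?_ ?_
  · intro a ha b hb c hc hab hbc
    obtain ⟨A, hA, haA⟩ := Finset.mem_biUnion.1 ha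
    obtain ⟨A', hA', hbA⟩ := Finset.mem_biUnion.1 hb
    obtain ⟨A'', hA'', hcA⟩ := Finset.mem_biUnion.1 hc
    have ha' := hS _ haA
    have hb' := hS _ hbA
    have hc' := hS _ hcA
    by_cases h1 : A = A'
    · subst h1
      by_cases h2 : A = A''
      · subst h2
        exact hStr A a haA b hbA c hcA hab hbc
      · exact hP A (hJP _ hA) A'' (hJP _ hA'') h2 b hb' a ha' c hc' c hc' hbc
    · by_cases h2 : A' = A''
      · subst h2
        exact hP A (hJP _ hA) A' (hJP _ hA') h1 a ha' a ha' b hb' c hc' hab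
      · by_cases h3 : A = A''
        · subst h3
          have := hP A (hJP _ hA) A' (hJP _ hA') h1 a ha' c hc' b hb' b hb' hab
          exact absurd hbc (Adj.asymm this)
        -- With three distinct parts, the arcs are transferred to representatives in Z. A cyclic
        -- triangle there would force two of the representatives into one part.
        · have hr1 := hP A (hJP _ hA) A' (hJP _ hA') h1 a ha' _ (hrM A hA) b hb' _ (hrM _ hA') hab
          have hr2 := hP A' (hJP _ hA') A'' (hJP _ hA'') h2 b hb' _ (hrM _ hA') c hc' _
            (hrM _ hA'') hbc
          have hne : r A ≠ r A'' := fun h =>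
            Finset.disjoint_left.1 (hdisj A hA A'' hA'' h3) (hrM A hA) (h ▸ hrM A'' hA'')
          by_contra hac
          have hca : T.Adj (r A'') (r A) := by
            refine adj_of_not_adj hne fun h => hac ?_
            exact hP A (hJP _ hA) A'' (hJP _ hA'') h3 _ (hrM A hA) a ha' _ (hrM _ hA'') c hc' h
          obtain ⟨M, hM, h4, h5⟩ := hZ _ (hrZ A hA) _ (hrZ _ hA') _ (hrZ _ hA'') hr1 hr2 hca
          have e1 := P.eq_of_mem_parts hM (hJP A hA) h4 (hrM A hA)
          have e2 := P.eq_of_mem_parts hM (hJP A' hA') h5 (hrM A' hA')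
          exact h1 (e1.symm.trans e2)
  · intro a ha
    obtain ⟨A, hA, haA⟩ := Finset.mem_biUnion.1 ha
    exact hBX (P.le (hJP A hA) (hS A haA))

theorem tr_mono {X Y : Finset W} (h : X ⊆ Y) : T.tr X ≤ T.tr Y := by
  obtain ⟨Z, hZ, hZt, hc⟩ := T.exists_transOn_card_eq_tr X
  exact hc ▸ hZt.card_le_tr (hZ.trans h)

open scoped Classical in
theorem TransOn.union {Z Z' : Finset W} (h : T.TransOn Z) (h' : T.TransOn Z')
    (hZ : ∀ a ∈ Z, ∀ b ∈ Z', T.Adj a b) : T.TransOn (Z ∪ Z') := by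
  intro a ha b hb c hc hab hbc
  rw [Finset.mem_union] at ha hb hc
  rcases ha with ha | ha
  · rcases hc with hc | hc
    · rcases hb with hb | hb
      · exact h a ha b hb c hc hab hbc
      · exact absurd hbc (Adj.asymm (hZ c hc b hb))
    · exact hZ a ha c hc
  · rcases hb with hb | hb
    · exact absurd hab (Adj.asymm (hZ b hb a ha))
    · rcases hc with hc | hc
      · exact absurd hbc (Adj.asymm (hZ c hc b hb))
      · exact h' a ha b hb c hc hab hbc

/-! ### Critical sets and the existence of one boat -/

/-- `X` is a minimal counterexample to the bound `|X| ^ ε ≤ tr X`. -/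
structure IsCritical (T : Tournament W) (ε : ℝ) (X : Finset W) : Prop where
  tr_lt : (T.tr X : ℝ) < (X.card : ℝ) ^ ε
  le_tr : ∀ Y : Finset W, Y ⊂ X → (Y.card : ℝ) ^ ε ≤ T.tr Y

open scoped Classical in
-- Double counting of pairs (M, y) with M meeting N y, weighted by tr M; `sum_tr_le_tr` bounds the
-- contribution of each y.
theorem sum_card_mul_tr_le {B X Y : Finset W} {N : W → Finset W} (hBX : B ⊆ X)
    (P : Finpartition B)
    (hP : ∀ M ∈ P.parts, ∀ M' ∈ P.parts, M ≠ M' → ∀ a ∈ M, ∀ a' ∈ M, ∀ b ∈ M', ∀ b' ∈ M',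
        T.Adj a b → T.Adj a' b')
    (hN : ∀ y ∈ Y, ∀ a ∈ N y, ∀ b ∈ N y, ∀ c ∈ N y, T.Adj a b → T.Adj b c → T.Adj c a →
        ∃ M ∈ P.parts, a ∈ M ∧ b ∈ M) :
    ∑ M ∈ P.parts, (Y.filter fun y => ¬ Disjoint M (N y)).card * T.tr M ≤ Y.card * T.tr X := by
  have h : ∀ M ∈ P.parts, (Y.filter fun y => ¬ Disjoint M (N y)).card * T.tr M =
      ∑ y ∈ Y, if ¬ Disjoint M (N y) then T.tr M else 0 := by
    intro M _
    rw [← Finset.sum_filter, Finset.sum_const, smul_eq_mul]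
  rw [Finset.sum_congr rfl h, Finset.sum_comm, ← smul_eq_mul, ← Finset.sum_const]
  refine Finset.sum_le_sum fun y hy => ?_
  rw [← Finset.sum_filter]
  exact sum_tr_le_tr hBX P hP (hN y hy)

open scoped Classical in
/-- In a critical set there are no linear disjoint sets `B`, `Y` with a partition of `B` into small
modules which the out-neighbourhoods of vertices of `Y` meet in a transitive pattern. -/
theorem IsCritical.false_of_module_partition {ε b : ℝ} {X B Y : Finset W} {N : W → Finset W}
    (hX : T.IsCritical ε X) (hε : 0 < ε) (hε' : 2 * ε ≤ 1) (hb : 0 < b)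
    (hb1 : (8 / b) ^ (2 * ε) ≤ 2) (hb2 : 1 / 2 ≤ (b / 2) ^ ε) (hBX : B ⊆ X) (hYX : Y ⊆ X)
    (hBY : Disjoint B Y) (hB : b * X.card ≤ B.card) (hY : b * X.card ≤ Y.card)
    (hB0 : B.Nonempty) (hY0 : Y.Nonempty) (hNdef : ∀ y ∈ Y, ∀ v ∈ B, v ∉ N y → T.Adj v y)
    (P : Finpartition B) (hPcard : ∀ M ∈ P.parts, (M.card : ℝ) ≤ B.card / 8)
    (hP : ∀ M ∈ P.parts, ∀ M' ∈ P.parts, M ≠ M' → ∀ a ∈ M, ∀ a' ∈ M, ∀ b ∈ M', ∀ b' ∈ M',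
        T.Adj a b → T.Adj a' b')
    (hN : ∀ y ∈ Y, ∀ a ∈ N y, ∀ b ∈ N y, ∀ c ∈ N y, T.Adj a b → T.Adj b c → T.Adj c a →
        ∃ M ∈ P.parts, a ∈ M ∧ b ∈ M) : False := by
  have hproper : ∀ {A : Finset W}, A ⊆ B → A ⊂ X := by
    intro A hA
    obtain ⟨y, hy⟩ := hY0
    exact (Finset.ssubset_iff_of_subset (hA.trans hBX)).2
      ⟨y, hYX hy, fun h => Finset.disjoint_left.1 hBY (hA h) hy⟩
  have hproperY : ∀ {A : Finset W}, A ⊆ Y → A ⊂ X := by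
    intro A hA
    obtain ⟨y, hy⟩ := hB0
    exact (Finset.ssubset_iff_of_subset (hA.trans hYX)).2
      ⟨y, hBX hy, fun h => Finset.disjoint_left.1 hBY hy (hA h)⟩
  set n : ℝ := (X.card : ℝ) with hn
  set β : ℝ := (B.card : ℝ) with hβ
  set γ : ℝ := (Y.card : ℝ) with hγ
  set τ : ℝ := (T.tr X : ℝ) with hτ
  have hβ0 : 0 < β := Nat.cast_pos.2 hB0.card_pos
  have hγ0 : 0 < γ := Nat.cast_pos.2 hY0.card_pos
  have hn0 : 0 < n := Nat.cast_pos.2 ((hB0.mono hBX).card_pos)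
  have hτ0 : 0 < τ := by
    have h1 := hX.le_tr Y (hproperY subset_rfl)
    have h2 : (T.tr Y : ℝ) ≤ τ := Nat.cast_le.2 (tr_mono hYX)
    have h3 : 0 < γ ^ ε := Real.rpow_pos_of_pos hγ0 ε
    linarith
  have hτq : τ < n ^ ε := hX.tr_lt
  set p : Finset W → ℝ := fun M => ((Y.filter fun y => ¬ Disjoint M (N y)).card : ℝ) with hp
  have hsum : ∑ M ∈ P.parts, p M * T.tr M ≤ γ * τ := by
    have := sum_card_mul_tr_le hBX P hP hN
    rw [hγ, hτ, hp]
    beta_reduce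
    exact_mod_cast this
  -- A part is good if its weight p M · tr M is at most twice its proportional share |M|τγ/β of the
  -- total γτ. By averaging, the bad parts cover at most half of B.
  set good := P.parts.filter (fun M => p M * T.tr M * β ≤ 2 * M.card * τ * γ) with hgood
  set G := good.biUnion id with hG
  have hgP : good ⊆ P.parts := Finset.filter_subset _ _
  have hGB : G ⊆ B := Finset.biUnion_subset.2 fun M hM => P.le (hgP hM)
  have hGcard : (G.card : ℝ) = ∑ M ∈ good, (M.card : ℝ) := by
    rw [hG, Finset.card_biUnion, Nat.cast_sum]
    · rfl
    · exact fun M hM M' hM' hne => P.disjoint (hgP hM) (hgP hM') hne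
  have hGhalf : β / 2 ≤ G.card := by
    have h1 : ∑ M ∈ P.parts, (M.card : ℝ) = β := by
      rw [hβ]
      exact_mod_cast P.sum_card_parts
    rw [← Finset.sum_filter_add_sum_filter_not P.parts
      (fun M => p M * T.tr M * β ≤ 2 * M.card * τ * γ), ← hgood, ← hGcard] at h1
    set S := ∑ M ∈ P.parts.filter (fun M => ¬ p M * T.tr M * β ≤ 2 * M.card * τ * γ),
      (M.card : ℝ) with hS
    have h2 : S * (2 * τ * γ) ≤ γ * τ * β := by
      rw [hS, Finset.sum_mul]
      refine le_trans ?_ (mul_le_mul_of_nonneg_right hsum hβ0.le)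
      rw [Finset.sum_mul]
      refine le_trans (Finset.sum_le_sum fun M hM => ?_)
        (Finset.sum_le_sum_of_subset_of_nonneg (Finset.filter_subset _ _) fun M _ _ => ?_)
      · have := not_le.1 (Finset.mem_filter.1 hM).2
        linarith
      · positivity
    have h3 : S ≤ β / 2 := by
      have : 0 < 2 * τ * γ := by positivity
      refine le_of_mul_le_mul_right ?_ this
      linarith
    linarith
  obtain ⟨Z, hZG, hZt, hZcard⟩ := T.exists_transOn_card_eq_tr G
  have hpow : ∀ {A : Finset W}, A ⊂ X → b / 2 * n ≤ A.card → (b / 2) ^ ε * n ^ ε ≤ T.tr A := by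
    intro A hA hle
    rw [← Real.mul_rpow (by positivity) hn0.le]
    exact (Real.rpow_le_rpow (by positivity) hle hε.le).trans (hX.le_tr A hA)
  have hZbig : (b / 2) ^ ε * n ^ ε ≤ Z.card := by
    rw [hZcard]
    exact hpow (hproper hGB) (by linarith)
  set I := P.parts.filter (fun M => ¬ Disjoint M Z) with hI
  have hIgood : ∀ M ∈ I, M ∈ good := by
    intro M hM
    obtain ⟨hMP, hMZ⟩ := Finset.mem_filter.1 hM
    obtain ⟨z, hzM, hzZ⟩ := Finset.not_disjoint_iff.1 hMZ
    obtain ⟨M', hM', hzM'⟩ := Finset.mem_biUnion.1 (hZG hzZ)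
    rwa [P.eq_of_mem_parts hMP (hgP hM') hzM hzM']
  have hIsum : ∑ M ∈ I, (T.tr M : ℝ) ≤ τ := by
    -- As Z is itself transitive, the condition on cyclic triangles is vacuous.
    have : ∑ M ∈ I, T.tr M ≤ T.tr X := sum_tr_le_tr hBX P hP fun a ha b hb c hc hab hbc hca =>
      absurd (hZt a ha b hb c hc hab hbc) (Adj.asymm hca)
    rw [hτ]
    exact_mod_cast this
  -- Writing |M| = (|M|^ε)² |M|^(1-2ε), with |M|^ε ≤ tr M by minimality and |M| ≤ β/8, gives |M| ≤
  -- (tr M)² D. For good M this bounds p M linearly in tr M, so p can be summed over the parts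
  -- meeting Z.
  set D : ℝ := (β / 8) ^ (1 - 2 * ε) with hD
  have hD0 : 0 < D := Real.rpow_pos_of_pos (by positivity) _
  have hpM : ∀ M ∈ I, p M * β ≤ 2 * τ * γ * D * T.tr M := by
    intro M hM
    have hMg := hIgood M hM
    have hMP := hgP hMg
    have hM0 : (0 : ℝ) < M.card := Nat.cast_pos.2 (P.nonempty_of_mem_parts hMP).card_pos
    have h1 : (M.card : ℝ) ^ ε ≤ T.tr M := hX.le_tr M (hproper (P.le hMP))
    have h0 : 0 < (M.card : ℝ) ^ ε := Real.rpow_pos_of_pos hM0 ε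
    have h2 : (M.card : ℝ) ≤ (T.tr M : ℝ) ^ 2 * D := by
      have h3 : (M.card : ℝ) = ((M.card : ℝ) ^ ε) ^ 2 * (M.card : ℝ) ^ (1 - 2 * ε) := by
        rw [← Real.rpow_natCast, ← Real.rpow_mul hM0.le, ← Real.rpow_add hM0]
        rw [Nat.cast_ofNat, show ε * 2 + (1 - 2 * ε) = 1 by ring, Real.rpow_one]
      have h4 : (M.card : ℝ) ^ (1 - 2 * ε) ≤ D :=
        Real.rpow_le_rpow hM0.le (hPcard M hMP) (by linarith)
      calc (M.card : ℝ) = ((M.card : ℝ) ^ ε) ^ 2 * (M.card : ℝ) ^ (1 - 2 * ε) := h3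
        _ ≤ (T.tr M : ℝ) ^ 2 * D :=
          mul_le_mul (pow_le_pow_left₀ h0.le h1 2) h4 (Real.rpow_nonneg hM0.le _) (sq_nonneg _)
    have h5 := (Finset.mem_filter.1 hMg).2
    have h6 : 0 < (T.tr M : ℝ) := h0.trans_le h1
    refine le_of_mul_le_mul_right ?_ h6
    calc p M * β * T.tr M = p M * T.tr M * β := by ring
      _ ≤ 2 * M.card * τ * γ := h5
      _ ≤ 2 * ((T.tr M : ℝ) ^ 2 * D) * τ * γ := by gcongr
      _ = 2 * τ * γ * D * T.tr M * T.tr M := by ring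
  have hpsum : ∑ M ∈ I, p M ≤ γ / 2 := by
    have h1 : (∑ M ∈ I, p M) * β ≤ 2 * τ * γ * D * τ := by
      rw [Finset.sum_mul]
      refine (Finset.sum_le_sum hpM).trans ?_
      rw [← Finset.mul_sum]
      gcongr
    -- This is where τ < n^ε enters, through n ≤ (8/b)(β/8); ε is so small that (8/b)^(2ε) costs
    -- only a factor 2.
    have h2 : τ * τ ≤ 2 * (β / 8) ^ (2 * ε) := by
      calc τ * τ ≤ n ^ ε * n ^ ε := by gcongr
        _ = n ^ (2 * ε) := by rw [← Real.rpow_add hn0]; ring_nf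
        _ ≤ (8 / b * (β / 8)) ^ (2 * ε) := by
          refine Real.rpow_le_rpow hn0.le ?_ (by positivity)
          rw [show 8 / b * (β / 8) = β / b by ring, le_div_iff₀ hb]
          linarith
        _ = (8 / b) ^ (2 * ε) * (β / 8) ^ (2 * ε) := by
          rw [Real.mul_rpow (by positivity) (by positivity)]
        _ ≤ 2 * (β / 8) ^ (2 * ε) := by gcongr
    have h3 : (β / 8) ^ (2 * ε) * D = β / 8 := by
      rw [hD, ← Real.rpow_add (by positivity)]
      norm_num
    refine le_of_mul_le_mul_right ?_ hβ0
    calc (∑ M ∈ I, p M) * β ≤ 2 * γ * D * (τ * τ) := by linarith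
      _ ≤ 2 * γ * D * (2 * (β / 8) ^ (2 * ε)) := by gcongr
      _ = 4 * γ * ((β / 8) ^ (2 * ε) * D) := by ring
      _ = γ / 2 * β := by rw [h3]; ring
  -- Every vertex of Z has an arc to every vertex of `Y'`, so transitive sets in the two can be
  -- concatenated.
  set Y' := Y.filter (fun y => Disjoint Z (N y)) with hY'
  have hY'card : γ / 2 ≤ Y'.card := by
    have h1 : (Y.filter fun y => ¬ Disjoint Z (N y)) ⊆
        I.biUnion fun M => Y.filter fun y => ¬ Disjoint M (N y) := by
      intro y hy
      obtain ⟨hy, hZy⟩ := Finset.mem_filter.1 hy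
      obtain ⟨z, hz, hzN⟩ := Finset.not_disjoint_iff.1 hZy
      obtain ⟨M, hM, hzM⟩ := P.exists_mem (hGB (hZG hz))
      refine Finset.mem_biUnion.2 ⟨M, Finset.mem_filter.2 ⟨hM, ?_⟩,
        Finset.mem_filter.2 ⟨hy, Finset.not_disjoint_iff.2 ⟨z, hzM, hzN⟩⟩⟩
      exact Finset.not_disjoint_iff.2 ⟨z, hzM, hz⟩
    have h2 : ((Y.filter fun y => ¬ Disjoint Z (N y)).card : ℝ) ≤ ∑ M ∈ I, p M := by
      have := (Finset.card_le_card h1).trans Finset.card_biUnion_le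
      rw [hp]
      beta_reduce
      exact_mod_cast this
    have h3 : (Y'.card : ℝ) + (Y.filter fun y => ¬ Disjoint Z (N y)).card = γ := by
      have := Finset.card_filter_add_card_filter_not (s := Y) (fun y => Disjoint Z (N y))
      rw [hγ]
      exact_mod_cast this
    linarith
  have hY'Y : Y' ⊆ Y := Finset.filter_subset _ _
  obtain ⟨Z', hZ'Y, hZ't, hZ'card⟩ := T.exists_transOn_card_eq_tr Y'
  have hZ'big : (b / 2) ^ ε * n ^ ε ≤ Z'.card := by
    rw [hZ'card]
    exact hpow (hproperY hY'Y) (by linarith)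
  have hZB : Z ⊆ B := hZG.trans hGB
  have hunion : T.TransOn (Z ∪ Z') := by
    refine hZt.union hZ't fun a ha y hy => ?_
    obtain ⟨hyY, hd⟩ := Finset.mem_filter.1 (hZ'Y hy)
    exact hNdef y hyY a (hZB ha) (Finset.disjoint_left.1 hd ha)
  have hle : ((Z ∪ Z').card : ℝ) ≤ τ := Nat.cast_le.2
    (hunion.card_le_tr (Finset.union_subset (hZB.trans hBX) ((hZ'Y.trans hY'Y).trans hYX)))
  rw [Finset.card_union_of_disjoint (hBY.mono hZB (hZ'Y.trans hY'Y)), Nat.cast_add] at hle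
  have hq : 0 < n ^ ε := Real.rpow_pos_of_pos hn0 ε
  -- Both pieces have size at least n^ε/2, so together they exceed τ.
  nlinarith

open scoped Classical in
/-- In a critical set, disjoint linear sets `B`, `Y` with few arcs from each vertex of `Y` to `B`
contain a cyclic triangle in `B` and a vertex of `Y` with exactly two out-neighbours in it. -/
theorem IsCritical.exists_boat {ε b : ℝ} {X B Y : Finset W}
    (hX : T.IsCritical ε X) (hε : 0 < ε) (hε' : 2 * ε ≤ 1) (hb : 0 < b)
    (hb1 : (8 / b) ^ (2 * ε) ≤ 2) (hb2 : 1 / 2 ≤ (b / 2) ^ ε) (hBX : B ⊆ X) (hYX : Y ⊆ X)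
    (hBY : Disjoint B Y) (hB : b * X.card ≤ B.card) (hY : b * X.card ≤ Y.card)
    (hB0 : 8 ≤ B.card) (hY0 : Y.Nonempty)
    (hN : ∀ y ∈ Y, ((B.filter (T.Adj y)).card : ℝ) ≤ B.card / 8) :
    ∃ y ∈ Y, ∃ x ∈ B, ∃ u ∈ B, ∃ v ∈ B, T.Adj x u ∧ T.Adj u v ∧ T.Adj v x ∧
      T.Adj y x ∧ T.Adj y u ∧ T.Adj v y := by
  by_contra hcon
  push Not at hcon
  have hne : ∀ {y v}, y ∈ Y → v ∈ B → y ≠ v := by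
    rintro y v hy hv rfl
    exact Finset.disjoint_left.1 hBY hv hy
  -- A cyclic triangle with exactly two vertices in the out-neighbourhood of y, together with y, is
  -- a boat.
  have hunsplit : ∀ y ∈ Y, T.Unsplit B (B.filter (T.Adj y)) := by
    intro y hy a ha c hc v hv hvN hac hcv hva
    rw [Finset.mem_filter] at ha hc hvN
    have hvy : T.Adj v y := adj_of_not_adj (hne hy hv) fun h => hvN ⟨hv, h⟩
    exact hcon y hy a ha.1 c hc.1 v hv hac hcv hva ha.2 hc.2 hvy
  obtain ⟨P, hP1, hP2, hP3⟩ := exists_module_partition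
    (fun y _ => Finset.filter_subset (T.Adj y) B) hunsplit
  refine hX.false_of_module_partition hε hε' hb hb1 hb2 hBX hYX hBY hB hY
    (Finset.card_pos.1 (by omega)) hY0 (N := fun y => B.filter (T.Adj y)) ?_ P ?_ hP2 hP3
  · intro y hy v hv hvN
    exact adj_of_not_adj (hne hy hv) fun h => hvN (Finset.mem_filter.2 ⟨hv, h⟩)
  · intro M hM
    rcases hP1 M hM with h | ⟨y, hy, h⟩
    · have h1 : (M.card : ℝ) ≤ 1 := by exact_mod_cast h
      have h2 : (8 : ℝ) ≤ B.card := by exact_mod_cast hB0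
      linarith
    · exact (Nat.cast_le.2 (Finset.card_le_card h)).trans (hN y hy)

/-! ### Sparse pairs and smooth sequences in tournaments omitting a pattern -/

open scoped Classical in
/-- The density of arcs from `A` to `B` is at most `δ`. -/
def FewArcs (T : Tournament W) (δ : ℝ) (A B : Finset W) : Prop :=
  ∑ a ∈ A, ((B.filter (fun b => T.Adj a b)).card : ℝ) ≤ δ * A.card * B.card

open scoped Classical in
theorem sum_card_filter_adj_comm (T : Tournament W) (A B : Finset W) :
    ∑ a ∈ A, ((B.filter (fun b => T.Adj a b)).card : ℝ) =
      ∑ b ∈ B, ((A.filter (fun a => T.Adj a b)).card : ℝ) := by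
  have := Finset.sum_card_bipartiteAbove_eq_sum_card_bipartiteBelow (s := A) (t := B) T.Adj
  unfold Finset.bipartiteAbove Finset.bipartiteBelow at this
  exact_mod_cast this

/-- `φ` embeds the pattern `D`, where `D i j` with `i < j` prescribes the direction of the arc
between the images of `i` and `j`. -/
def RealizesPattern (T : Tournament W) {h : ℕ} (D : Fin h → Fin h → Prop) (φ : Fin h → W) : Prop :=
  ∀ i j, i < j → (D i j → T.Adj (φ i) (φ j)) ∧ (¬ D i j → T.Adj (φ j) (φ i))

/-- Greedy embedding: if some vertex of the first set has a δ-fraction of correctly directed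
neighbours in every other set, recurse into those neighbourhoods. Otherwise, by pigeonhole, many
vertices of the first set fail for the same j, which gives the sparse pair. -/
theorem exists_pattern_or_fewArcs {δ : ℝ} (hδ : 0 < δ) (h : ℕ) :
    ∃ c : ℝ, 0 < c ∧ ∀ {W : Type v} (T : Tournament W) (D : Fin h → Fin h → Prop)
      (S : Fin h → Finset W) (s : ℝ), 0 < s → (∀ i, s ≤ (S i).card) →
      (∃ φ : Fin h → W, (∀ i, φ i ∈ S i) ∧ T.RealizesPattern D φ) ∨
      ∃ i j, i ≠ j ∧ ∃ A ⊆ S i, ∃ B ⊆ S j, c * s ≤ A.card ∧ c * s ≤ B.card ∧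
        (T.FewArcs δ A B ∨ T.FewArcs δ B A) := by
  classical
  induction h with
  | zero => exact ⟨1, one_pos, fun T D S s _ _ => Or.inl ⟨Fin.elim0, fun i => i.elim0,
      fun i => i.elim0⟩⟩
  | succ h ih =>
    obtain ⟨c, hc, ih⟩ := ih
    have hh : (0 : ℝ) < h + 1 := by positivity
    refine ⟨min (c * δ) (1 / (h + 1)), by positivity, fun {W} T D S s hs hS => ?_⟩
    set R : W → Fin h → Finset W := fun v j => (S j.succ).filter
      (fun w => if D 0 j.succ then T.Adj v w else T.Adj w v) with hR
    have hRS : ∀ v j, R v j ⊆ S j.succ := fun v j => Finset.filter_subset _ _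
    by_cases hv : ∃ v ∈ S 0, ∀ j, δ * (S j.succ).card ≤ (R v j).card
    · obtain ⟨v, hvS, hv⟩ := hv
      rcases ih T (fun i j => D i.succ j.succ) (R v) (δ * s) (by positivity) (fun j =>
        (mul_le_mul_of_nonneg_left (hS j.succ) hδ.le).trans (hv j)) with
        ⟨φ, hφ, hφD⟩ | ⟨i, j, hij, A, hA, B, hB, hAc, hBc, hAB⟩
      · left
        refine ⟨Fin.cons v φ, ?_, ?_⟩
        · intro i
          refine Fin.cases ?_ (fun i => ?_) i
          · exact hvS
          · exact hRS v i (hφ i)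
        · intro i j
          refine Fin.cases ?_ (fun j => ?_) j
          · intro h
            exact absurd h (Fin.not_lt_zero i)
          refine Fin.cases ?_ (fun i => ?_) i
          · intro _
            have := (Finset.mem_filter.1 (hφ j)).2
            refine ⟨fun hD => ?_, fun hD => ?_⟩
            · rwa [if_pos hD] at this
            · rwa [if_neg hD] at this
          · intro hij
            exact hφD i j (Fin.succ_lt_succ_iff.1 hij)
      · right
        have hle : min (c * δ) (1 / (h + 1)) * s ≤ c * (δ * s) := by
          rw [← mul_assoc]
          exact mul_le_mul_of_nonneg_right (min_le_left _ _) hs.le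
        exact ⟨i.succ, j.succ, fun e => hij (Fin.succ_injective _ e), A, hA.trans (hRS v i), B,
          hB.trans (hRS v j), hle.trans hAc, hle.trans hBc, hAB⟩
    · right
      push Not at hv
      set A : Fin h → Finset W := fun j =>
        (S 0).filter (fun v => ((R v j).card : ℝ) < δ * (S j.succ).card) with hA
      have hcover : S 0 ⊆ Finset.univ.biUnion A := by
        intro v hvS
        obtain ⟨j, hj⟩ := hv v hvS
        exact Finset.mem_biUnion.2 ⟨j, Finset.mem_univ j, Finset.mem_filter.2 ⟨hvS, hj⟩⟩
      have hle : min (c * δ) (1 / ((h : ℝ) + 1)) * s ≤ s / (h + 1) := by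
        rw [show s / ((h : ℝ) + 1) = 1 / (h + 1) * s by ring]
        exact mul_le_mul_of_nonneg_right (min_le_right _ _) hs.le
      obtain ⟨j, hj⟩ : ∃ j, s / (h + 1) ≤ (A j).card := by
        by_contra hcon
        push Not at hcon
        have h1 : ((S 0).card : ℝ) ≤ ∑ j, ((A j).card : ℝ) := by
          exact_mod_cast (Finset.card_le_card hcover).trans Finset.card_biUnion_le
        have h2 : ∑ j, ((A j).card : ℝ) ≤ ∑ _j : Fin h, s / (h + 1) :=
          Finset.sum_le_sum fun j _ => (hcon j).le
        rw [Finset.sum_const, Finset.card_univ, Fintype.card_fin, nsmul_eq_mul] at h2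
        have h3 : (h : ℝ) * (s / (h + 1)) < s := by
          rw [← mul_div_assoc, div_lt_iff₀ hh]
          linarith
        linarith [hS 0]
      have hsum : ∑ v ∈ A j, ((R v j).card : ℝ) ≤ δ * (A j).card * (S j.succ).card := by
        calc ∑ v ∈ A j, ((R v j).card : ℝ) ≤ ∑ _v ∈ A j, δ * (S j.succ).card :=
              Finset.sum_le_sum fun v hv => (Finset.mem_filter.1 hv).2.le
          _ = δ * (A j).card * (S j.succ).card := by
              rw [Finset.sum_const, nsmul_eq_mul]
              ring
      refine ⟨0, j.succ, (Fin.succ_ne_zero j).symm, A j, Finset.filter_subset _ _, S j.succ,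
        subset_rfl, hle.trans hj, hle.trans ?_, ?_⟩
      · refine le_trans (div_le_self hs.le ?_) (hS j.succ)
        linarith [(Nat.cast_nonneg h : (0 : ℝ) ≤ h)]
      · by_cases hD : D 0 j.succ
        · left
          unfold FewArcs
          simpa only [hR, if_pos hD] using hsum
        · right
          unfold FewArcs
          rw [sum_card_filter_adj_comm]
          simp only [hR, if_neg hD] at hsum
          linarith

theorem exists_disjoint_subsets_card_eq (X : Finset W) (h m : ℕ) (hX : h * m ≤ X.card) :
    ∃ S : Fin h → Finset W, (∀ i, S i ⊆ X) ∧ (∀ i, (S i).card = m) ∧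
      ∀ i j, i ≠ j → Disjoint (S i) (S j) := by
  classical
  induction h generalizing X with
  | zero => exact ⟨Fin.elim0, fun i => i.elim0, fun i => i.elim0, fun i => i.elim0⟩
  | succ h ih =>
    rw [Nat.succ_mul] at hX
    obtain ⟨A, hA, hAc⟩ := Finset.exists_subset_card_eq (s := X) (n := m) (by omega)
    obtain ⟨S, hS, hSc, hSd⟩ := ih (X \ A) (by rw [Finset.card_sdiff_of_subset hA]; omega)
    have hd : ∀ i, Disjoint A (S i) := fun i =>
      Finset.disjoint_of_subset_right (hS i) Finset.disjoint_sdiff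
    refine ⟨Fin.cons A S, ?_, ?_, ?_⟩
    · intro i
      refine Fin.cases hA (fun i => (hS i).trans Finset.sdiff_subset) i
    · intro i
      refine Fin.cases hAc hSc i
    · intro i j
      refine Fin.cases ?_ (fun i => ?_) i <;> refine Fin.cases ?_ (fun j => ?_) j
      · exact fun h => absurd rfl h
      · exact fun _ => hd j
      · exact fun _ => (hd i).symm
      · exact fun hij => hSd i j fun e => hij (congrArg Fin.succ e)

/-- A large tournament omitting a pattern has two disjoint linear sets with few arcs from the
second to the first. -/
theorem exists_fewArcs_pair {δ : ℝ} (hδ : 0 < δ) (h : ℕ) :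
    ∃ c : ℝ, 0 < c ∧ ∃ N : ℝ, ∀ {W : Type v} (T : Tournament W) (D : Fin h → Fin h → Prop)
      (X : Finset W), N ≤ X.card → (¬ ∃ φ : Fin h → W, T.RealizesPattern D φ) →
      ∃ A ⊆ X, ∃ B ⊆ X, Disjoint A B ∧ c * X.card ≤ A.card ∧ c * X.card ≤ B.card ∧
        T.FewArcs δ B A := by
  obtain ⟨c, hc, key⟩ := exists_pattern_or_fewArcs.{v} hδ h
  -- The factor 2 absorbs the rounding in m; dividing by h + 1 covers h = 0.
  refine ⟨c / (2 * (h + 1)), by positivity, h + 1, fun T D X hX hD => ?_⟩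
  have hX' : h + 1 ≤ X.card := by exact_mod_cast hX
  set m := X.card / (h + 1) with hm
  obtain ⟨S, hSX, hSc, hSd⟩ := exists_disjoint_subsets_card_eq X h m
    ((Nat.mul_le_mul_right m (Nat.le_succ h)).trans (Nat.mul_div_le _ _))
  have hm1 : 1 ≤ m := (Nat.one_le_div_iff (Nat.succ_pos h)).2 hX'
  have hm2 : (X.card : ℝ) ≤ 2 * (h + 1) * m := by
    have h1 : X.card < (h + 1) * m + (h + 1) := by
      have : (h + 1) * m + X.card % (h + 1) = X.card := Nat.div_add_mod X.card (h + 1)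
      have := Nat.mod_lt X.card (show 0 < h + 1 by omega)
      omega
    have h2 : h + 1 ≤ (h + 1) * m := Nat.le_mul_of_pos_right _ hm1
    have h3 : X.card ≤ 2 * (h + 1) * m := by
      rw [mul_assoc]
      omega
    exact_mod_cast h3
  have hle : c / (2 * (h + 1)) * X.card ≤ c * m := by
    rw [div_mul_eq_mul_div, div_le_iff₀ (by positivity)]
    calc c * X.card ≤ c * (2 * (h + 1) * m) := by gcongr
      _ = c * m * (2 * (h + 1)) := by ring
  rcases key T D S m (by exact_mod_cast hm1) (fun i => by rw [hSc i]) with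
    ⟨φ, -, hφ⟩ | ⟨i, j, hij, A, hA, B, hB, hAc, hBc, hAB | hAB⟩
  · exact absurd ⟨φ, hφ⟩ hD
  · exact ⟨B, hB.trans (hSX j), A, hA.trans (hSX i), (hSd j i hij.symm).mono hB hA,
      hle.trans hBc, hle.trans hAc, hAB⟩
  · exact ⟨A, hA.trans (hSX i), B, hB.trans (hSX j), (hSd i j hij).mono hA hB,
      hle.trans hAc, hle.trans hBc, hAB⟩

/-- A large tournament omitting a pattern has a sequence of disjoint linear sets with few arcs from
later sets to earlier ones. -/
theorem exists_fewArcs_sequence {δ : ℝ} (hδ : 0 < δ) (h k : ℕ) :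
    ∃ c : ℝ, 0 < c ∧ ∃ N : ℝ, ∀ {W : Type v} (T : Tournament W) (D : Fin h → Fin h → Prop)
      (X : Finset W), N ≤ X.card → (¬ ∃ φ : Fin h → W, T.RealizesPattern D φ) →
      ∃ S : Fin k → Finset W, (∀ i, S i ⊆ X) ∧ (∀ i, c * X.card ≤ (S i).card) ∧
        ∀ i j, i < j → Disjoint (S i) (S j) ∧ T.FewArcs δ (S j) (S i) := by
  classical
  induction k with
  | zero => exact ⟨1, one_pos, 0, fun T D X _ _ => ⟨Fin.elim0, fun i => i.elim0,
      fun i => i.elim0, fun i => i.elim0⟩⟩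
  | succ k ih =>
    obtain ⟨c, hc, N, ih⟩ := ih
    -- Density δc, because the later sets occupy only a fraction c of B, and restricting to them can
    -- raise the density by a factor 1/c.
    obtain ⟨c', hc', N', pair⟩ := exists_fewArcs_pair.{v} (mul_pos hδ hc) h
    refine ⟨min (c * c') c', by positivity, max N' (N / c'), fun T D X hX hD => ?_⟩
    obtain ⟨A, hA, B, hB, hAB, hAc, hBc, hfew⟩ := pair T D X ((le_max_left _ _).trans hX) hD
    have hNB : N ≤ B.card := by
      refine le_trans ?_ hBc
      have := (le_max_right N' (N / c')).trans hX
      rwa [div_le_iff₀ hc', mul_comm] at this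
    obtain ⟨S, hSB, hSc, hS⟩ := ih T D B hNB hD
    have hX0 : (0 : ℝ) ≤ X.card := Nat.cast_nonneg _
    refine ⟨Fin.cons A S, ?_, ?_, ?_⟩
    · intro i
      exact Fin.cases hA (fun i => (hSB i).trans hB) i
    · intro i
      refine Fin.cases ?_ (fun i => ?_) i
      · exact (mul_le_mul_of_nonneg_right (min_le_right _ _) hX0).trans hAc
      · refine (mul_le_mul_of_nonneg_right (min_le_left _ _) hX0).trans (le_trans ?_ (hSc i))
        rw [mul_assoc]
        exact mul_le_mul_of_nonneg_left hBc hc.le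
    · intro i j
      refine Fin.cases ?_ (fun j => ?_) j
      · exact fun h => absurd h (Fin.not_lt_zero i)
      refine Fin.cases ?_ (fun i => ?_) i
      · refine fun _ => ⟨hAB.mono_right (hSB j), ?_⟩
        change T.FewArcs δ (S j) A
        unfold FewArcs at hfew ⊢
        calc ∑ b ∈ S j, ((A.filter (fun a => T.Adj b a)).card : ℝ)
            ≤ ∑ b ∈ B, ((A.filter (fun a => T.Adj b a)).card : ℝ) :=
              Finset.sum_le_sum_of_subset_of_nonneg (hSB j) fun _ _ _ => Nat.cast_nonneg _
          _ ≤ δ * c * B.card * A.card := hfew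
          _ = δ * (c * B.card) * A.card := by ring
          _ ≤ δ * (S j).card * A.card := by
              have := hSc j
              gcongr
      · exact fun hij => hS i j (Fin.succ_lt_succ_iff.1 hij)

open scoped Classical in
/-- The vertices of `S j` joined to the vertex `v` of `S i` by an arc directed from the later of
the two sets to the earlier one. -/
noncomputable def backNbrs (T : Tournament W) {k : ℕ} (S : Fin k → Finset W) (i j : Fin k)
    (v : W) : Finset W :=
  (S j).filter fun w => (i < j ∧ T.Adj w v) ∨ (j < i ∧ T.Adj v w)

theorem sum_card_backNbrs_le {k : ℕ} {S : Fin k → Finset W} {δ : ℝ} (hδ : 0 ≤ δ)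
    (hS : ∀ i j, i < j → T.FewArcs δ (S j) (S i)) (i j : Fin k) :
    ∑ v ∈ S i, ((T.backNbrs S i j v).card : ℝ) ≤ δ * (S i).card * (S j).card := by
  classical
  rcases lt_trichotomy i j with hij | rfl | hij
  · have := hS i j hij
    unfold FewArcs at this
    rw [sum_card_filter_adj_comm] at this
    simp only [backNbrs, hij, hij.not_gt, true_and, false_and, or_false]
    linarith
  · simp only [backNbrs, lt_irrefl, false_and, or_false, Finset.filter_false, Finset.card_empty,
      Nat.cast_zero, Finset.sum_const_zero]
    positivity
  · have := hS j i hij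
    unfold FewArcs at this
    simpa only [backNbrs, hij, hij.not_gt, true_and, false_and, false_or] using this

/-- A large tournament omitting a pattern has a sequence of disjoint linear sets in which each
vertex has few backward neighbours in each of the sets. -/
theorem exists_smooth_sequence {δ : ℝ} (hδ : 0 < δ) (h k : ℕ) :
    ∃ c : ℝ, 0 < c ∧ ∃ N : ℝ, ∀ {W : Type v} (T : Tournament W) (D : Fin h → Fin h → Prop)
      (X : Finset W), N ≤ X.card → (¬ ∃ φ : Fin h → W, T.RealizesPattern D φ) →
      ∃ S : Fin k → Finset W, (∀ i, S i ⊆ X) ∧ (∀ i, c * X.card ≤ (S i).card) ∧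
        (∀ i j, i < j → Disjoint (S i) (S j)) ∧
        ∀ i j, ∀ v ∈ S i, ((T.backNbrs S i j v).card : ℝ) ≤ δ * (S j).card := by
  classical
  have hk : (0 : ℝ) < k + 1 := by positivity
  -- With this density, Markov's inequality at threshold δ/2 leaves at most |S i|/(2(k+1)) bad
  -- vertices for each j, so deleting them for all j keeps half of S i. Halving S j turns δ/2 into
  -- δ.
  obtain ⟨c, hc, N, key⟩ := exists_fewArcs_sequence.{v}
    (show 0 < δ / (4 * (k + 1)) by positivity) h k
  refine ⟨c / 2, by positivity, max N 1, fun {W} T D X hX hD => ?_⟩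
  obtain ⟨S, hSX, hSc, hS⟩ := key T D X ((le_max_left _ _).trans hX) hD
  have hX0 : (0 : ℝ) < X.card := one_pos.trans_le ((le_max_right _ _).trans hX)
  have hS0 : ∀ i, (0 : ℝ) < (S i).card := fun i => (mul_pos hc hX0).trans_le (hSc i)
  set bad : Fin k → Fin k → Finset W := fun i j =>
    (S i).filter fun v => δ / 2 * (S j).card < (T.backNbrs S i j v).card with hbad
  have hbadc : ∀ i j, ((bad i j).card : ℝ) ≤ (S i).card / (2 * (k + 1)) := by
    intro i j
    have h1 := sum_card_backNbrs_le (by positivity) (fun i j hij => (hS i j hij).2) i j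
    have h2 : (bad i j).card * (δ / 2 * (S j).card) ≤
        ∑ v ∈ S i, ((T.backNbrs S i j v).card : ℝ) := by
      rw [← nsmul_eq_mul, ← Finset.sum_const]
      refine (Finset.sum_le_sum fun v hv => (Finset.mem_filter.1 hv).2.le).trans
        (Finset.sum_le_sum_of_subset_of_nonneg (Finset.filter_subset _ _)
          fun _ _ _ => Nat.cast_nonneg _)
    have h3 : 0 < δ / 2 * ((S j).card : ℝ) := mul_pos (by positivity) (hS0 j)
    refine le_of_mul_le_mul_right (h2.trans (h1.trans (le_of_eq ?_))) h3
    field_simp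
    ring
  set S' : Fin k → Finset W := fun i => S i \ Finset.univ.biUnion (bad i) with hS'
  have hS'S : ∀ i, S' i ⊆ S i := fun i => Finset.sdiff_subset
  have hS'c : ∀ i, ((S i).card : ℝ) / 2 ≤ (S' i).card := by
    intro i
    have h1 : ((Finset.univ.biUnion (bad i)).card : ℝ) ≤ ∑ j, ((bad i j).card : ℝ) := by
      exact_mod_cast Finset.card_biUnion_le
    have h2 : ∑ j, ((bad i j).card : ℝ) ≤ ∑ _j : Fin k, ((S i).card : ℝ) / (2 * (k + 1)) :=
      Finset.sum_le_sum fun j _ => hbadc i j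
    rw [Finset.sum_const, Finset.card_univ, Fintype.card_fin, nsmul_eq_mul] at h2
    have h3 : (k : ℝ) * ((S i).card / (2 * (k + 1))) ≤ (S i).card / 2 := by
      rw [← mul_div_assoc, div_le_div_iff₀ (by positivity) two_pos]
      nlinarith [hS0 i]
    have h4 : ((S i).card : ℝ) ≤ (S' i).card + (Finset.univ.biUnion (bad i)).card := by
      exact_mod_cast Finset.card_le_card_sdiff_add_card
    linarith
  refine ⟨S', fun i => (hS'S i).trans (hSX i), fun i => ?_,
    fun i j hij => (hS i j hij).1.mono (hS'S i) (hS'S j), fun i j v hv => ?_⟩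
  · linarith [hSc i, hS'c i]
  · have h1 : v ∉ bad i j := fun h =>
      (Finset.mem_sdiff.1 hv).2 (Finset.mem_biUnion.2 ⟨j, Finset.mem_univ j, h⟩)
    have h2 : ((T.backNbrs S i j v).card : ℝ) ≤ δ / 2 * (S j).card := by
      by_contra h
      exact h1 (Finset.mem_filter.2 ⟨hS'S i hv, not_le.1 h⟩)
    have h3 : T.backNbrs S' i j v ⊆ T.backNbrs S i j v :=
      Finset.filter_subset_filter _ (hS'S j)
    have h4 : ((T.backNbrs S' i j v).card : ℝ) ≤ (T.backNbrs S i j v).card :=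
      Nat.cast_le.2 (Finset.card_le_card h3)
    nlinarith [hS'c j]

theorem transOn_of_card_le_two {X : Finset W} (hX : X.card ≤ 2) : T.TransOn X := by
  intro a ha b hb c hc hab hbc
  have hac : a ≠ c := by
    rintro rfl
    exact Adj.asymm hab hbc
  exact absurd (Finset.two_lt_card.2 ⟨a, ha, b, hb, c, hc, Adj.ne hab, hac, Adj.ne hbc⟩) (not_lt.2 hX)

/-- Sets of at most two vertices are transitive and hence not critical; larger sets have tr X ≥ 2,
so |X|^ε > 2 ≥ N^ε. A small ε thus makes critical sets as large as desired. -/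
theorem IsCritical.le_card {ε N : ℝ} {X : Finset W} (hX : T.IsCritical ε X) (hε : 0 < ε)
    (hε' : ε ≤ 1) (hN : N ^ ε ≤ 2) : N ≤ X.card := by
  have hlt := hX.tr_lt
  rcases le_or_gt X.card 2 with h | h
  · have h1 : (X.card : ℝ) ≤ T.tr X :=
      Nat.cast_le.2 ((transOn_of_card_le_two h).card_le_tr subset_rfl)
    have h2 : (X.card : ℝ) ^ ε ≤ X.card := by
      rcases Nat.eq_zero_or_pos X.card with h0 | h0
      · rw [h0, Nat.cast_zero, Real.zero_rpow hε.ne']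
      · exact Real.rpow_le_self_of_one_le (by exact_mod_cast h0) hε'
    linarith
  · obtain ⟨Z, hZ, hZc⟩ := Finset.exists_subset_card_eq h.le
    have h1 : (2 : ℝ) ≤ T.tr X := by
      have := (transOn_of_card_le_two (T := T) hZc.le).card_le_tr hZ
      rw [hZc] at this
      exact_mod_cast this
    by_contra hcon
    have := Real.rpow_le_rpow (Nat.cast_nonneg _) (not_le.1 hcon).le hε.le
    linarith

theorem adj_of_notMem_backNbrs {k : ℕ} {S : Fin k → Finset W}
    (hS : ∀ i j, i ≠ j → Disjoint (S i) (S j)) {i j : Fin k} {v w : W} (hv : v ∈ S i)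
    (hw : w ∈ S j) (h : w ∉ T.backNbrs S i j v) :
    (i < j → T.Adj v w) ∧ (j < i → T.Adj w v) := by
  classical
  have hne : i ≠ j → v ≠ w := by
    rintro hij rfl
    exact Finset.disjoint_left.1 (hS i j hij) hv hw
  refine ⟨fun hij => adj_of_not_adj (hne hij.ne).symm fun hadj => h ?_,
    fun hij => adj_of_not_adj (hne hij.ne') fun hadj => h ?_⟩
  · exact Finset.mem_filter.2 ⟨hw, Or.inl ⟨hij, hadj⟩⟩
  · exact Finset.mem_filter.2 ⟨hw, Or.inr ⟨hij, hadj⟩⟩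

/-! ### Greedy placement of boats -/

/-- In a critical set with a smooth sequence of linear sets, disjoint boats can be found, each with
its first three vertices in one prescribed set and the last one in a later prescribed set, such that
arcs between different boats are directed forward. -/
theorem IsCritical.exists_boats {ε c δ : ℝ} {X : Finset W} (hX : T.IsCritical ε X) (hε : 0 < ε)
    (hε' : 2 * ε ≤ 1) (hc : 0 < c) (hc1 : (16 / c) ^ (2 * ε) ≤ 2) (hc2 : 1 / 2 ≤ (c / 4) ^ ε)
    (hcX : 16 / c ≤ X.card) {k : ℕ} {S : Fin k → Finset W} (hSX : ∀ i, S i ⊆ X)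
    (hSc : ∀ i, c * X.card ≤ (S i).card) (hS : ∀ i j, i ≠ j → Disjoint (S i) (S j))
    (hSδ : ∀ i j, ∀ v ∈ S i, ((T.backNbrs S i j v).card : ℝ) ≤ δ * (S j).card)
    {ι : Type*} (pl : ι → Fin 4 → Fin k) (h01 : ∀ C, pl C 1 = pl C 0)
    (h02 : ∀ C, pl C 2 = pl C 0) (h03 : ∀ C, pl C 0 < pl C 3)
    (s : Finset ι)
    (hδ : 16 * (s.card + 1) * δ ≤ 1) :
    ∃ φ : ι → Fin 4 → W, (∀ C ∈ s, ∀ a, φ C a ∈ S (pl C a)) ∧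
      (∀ C ∈ s, ∀ a b, boat.Adj a b → T.Adj (φ C a) (φ C b)) ∧
      ∀ C ∈ s, ∀ C' ∈ s, C ≠ C' → ∀ a a', pl C a < pl C' a' → T.Adj (φ C a) (φ C' a') := by
  classical
  have hX16 : 16 ≤ c * X.card := by
    rwa [div_le_iff₀ hc, mul_comm] at hcX
  have hX0 : (0 : ℝ) < X.card := (show 0 < 16 / c by positivity).trans_le hcX
  obtain ⟨w₀⟩ : Nonempty W := by
    obtain ⟨w, -⟩ := Finset.card_pos.1 (Nat.cast_pos.1 hX0)
    exact ⟨w⟩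
  induction s using Finset.induction_on with
  | empty =>
    exact ⟨fun _ _ => w₀, fun C hC => absurd hC (Finset.notMem_empty C),
      fun C hC => absurd hC (Finset.notMem_empty C), fun C hC => absurd hC (Finset.notMem_empty C)⟩
  | @insert C s hCs ih =>
    rw [Finset.card_insert_of_notMem hCs] at hδ
    push_cast at hδ
    -- A negative δ would violate the bound on backward neighbours, as the sets are nonempty.
    have hδ0 : 0 ≤ δ := by
      by_contra hneg
      have hne : (S (pl C 0)).Nonempty := by
        rw [← Finset.card_pos, ← Nat.cast_pos (α := ℝ)]
        linarith [hSc (pl C 0)]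
      obtain ⟨v, hv⟩ := hne
      have h1 := hSδ _ (pl C 0) v hv
      have h2 : (0 : ℝ) ≤ (T.backNbrs S (pl C 0) (pl C 0) v).card := Nat.cast_nonneg _
      nlinarith [hSc (pl C 0)]
    obtain ⟨φ, hφS, hφb, hφ⟩ := ih (by nlinarith)
    -- Avoiding the backward neighbours of all vertices placed so far forces forward arcs to the new
    -- boat and removes at most half of each set. Hence `exists_boat` is applied with b = c/2.
    set bad : Fin k → Finset W := fun j => s.biUnion fun C' => Finset.univ.biUnion fun a =>
      T.backNbrs S (pl C' a) j (φ C' a) with hbad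
    have hbadc : ∀ j, ((bad j).card : ℝ) ≤ (S j).card / 2 := by
      intro j
      have h1 : (bad j).card ≤ ∑ C' ∈ s, ∑ a, (T.backNbrs S (pl C' a) j (φ C' a)).card :=
        Finset.card_biUnion_le.trans (Finset.sum_le_sum fun C' _ => Finset.card_biUnion_le)
      have h2 : ((bad j).card : ℝ) ≤ ∑ C' ∈ s, ∑ _a : Fin 4, δ * (S j).card := by
        refine (show ((bad j).card : ℝ) ≤ ∑ C' ∈ s, ∑ a,
          ((T.backNbrs S (pl C' a) j (φ C' a)).card : ℝ) by exact_mod_cast h1).trans ?_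
        exact Finset.sum_le_sum fun C' hC' => Finset.sum_le_sum fun a _ =>
          hSδ _ _ _ (hφS C' hC' a)
      simp only [Finset.sum_const, Finset.card_univ, Fintype.card_fin, nsmul_eq_mul] at h2
      push_cast at h2
      have h3 : (0 : ℝ) ≤ (S j).card := Nat.cast_nonneg _
      have h4 : (s.card : ℝ) * (4 * δ) ≤ 1 / 2 := by linarith
      nlinarith
    have hhalf : ∀ j, ((S j).card : ℝ) / 2 ≤ (S j \ bad j).card := by
      intro j
      have h4 : ((S j).card : ℝ) ≤ (S j \ bad j).card + (bad j).card := by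
        exact_mod_cast Finset.card_le_card_sdiff_add_card
      linarith [hbadc j]
    have hbig : ∀ j, c / 2 * X.card ≤ (S j \ bad j).card := by
      intro j
      linarith [hSc j, hhalf j]
    have hsub : ∀ j, S j \ bad j ⊆ S j := fun j => Finset.sdiff_subset
    obtain ⟨y, hy, x, hx, u, hu, v, hv, hxu, huv, hvx, hyx, hyu, hvy⟩ :=
      hX.exists_boat (B := S (pl C 0) \ bad (pl C 0)) (Y := S (pl C 3) \ bad (pl C 3)) hε hε'
        (show 0 < c / 2 by positivity) (by rwa [show 8 / (c / 2) = 16 / c by field_simp; norm_num])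
        (by rwa [show c / 2 / 2 = c / 4 by ring])
        ((hsub _).trans (hSX _)) ((hsub _).trans (hSX _))
        ((hS _ _ (h03 C).ne).mono (hsub _) (hsub _)) (hbig _) (hbig _)
        (by
          have := hbig (pl C 0)
          have h8 : (8 : ℝ) ≤ (S (pl C 0) \ bad (pl C 0)).card := by linarith
          exact_mod_cast h8)
        (by
          rw [← Finset.card_pos, ← Nat.cast_pos (α := ℝ)]
          linarith [hbig (pl C 3)])
        (by
          intro y hy
          have h1 : (S (pl C 0) \ bad (pl C 0)).filter (T.Adj y) ⊆
              T.backNbrs S (pl C 3) (pl C 0) y := by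
            intro w hw
            rw [Finset.mem_filter] at hw
            exact Finset.mem_filter.2 ⟨hsub _ hw.1, Or.inr ⟨h03 C, hw.2⟩⟩
          have h2 := hSδ (pl C 3) (pl C 0) y (hsub _ hy)
          have h3 : (((S (pl C 0) \ bad (pl C 0)).filter (T.Adj y)).card : ℝ) ≤
            (T.backNbrs S (pl C 3) (pl C 0) y).card := Nat.cast_le.2 (Finset.card_le_card h1)
          have h4 := hhalf (pl C 0)
          have h5 : δ ≤ 1 / 16 := by nlinarith [(Nat.cast_nonneg s.card : (0 : ℝ) ≤ s.card)]
          have h6 : (0 : ℝ) ≤ (S (pl C 0)).card := Nat.cast_nonneg _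
          nlinarith)
    set ψ : Fin 4 → W := ![x, u, v, y] with hψ
    have hψS : ∀ a, ψ a ∈ S (pl C a) \ bad (pl C a) := by
      intro a
      fin_cases a
      · exact hx
      · change u ∈ S (pl C 1) \ bad (pl C 1)
        rwa [h01]
      · change v ∈ S (pl C 2) \ bad (pl C 2)
        rwa [h02]
      · exact hy
    have hψb : ∀ a b, boat.Adj a b → T.Adj (ψ a) (ψ b) := by
      intro a b hab
      simp only [boat, Prod.mk.injEq] at hab
      rcases hab with ⟨rfl, rfl⟩ | ⟨rfl, rfl⟩ | ⟨rfl, rfl⟩ | ⟨rfl, rfl⟩ | ⟨rfl, rfl⟩ | ⟨rfl, rfl⟩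
      · exact hyx
      · exact hyu
      · exact hvx
      · exact hxu
      · exact huv
      · exact hvy
    have hcross : ∀ C' ∈ s, ∀ a a', (pl C' a < pl C a' → T.Adj (φ C' a) (ψ a')) ∧
        (pl C a' < pl C' a → T.Adj (ψ a') (φ C' a)) := by
      intro C' hC' a a'
      refine adj_of_notMem_backNbrs hS (hφS C' hC' a) (hsub _ (hψS a')) fun h => ?_
      exact (Finset.mem_sdiff.1 (hψS a')).2 (Finset.mem_biUnion.2 ⟨C', hC',
        Finset.mem_biUnion.2 ⟨a, Finset.mem_univ a, h⟩⟩)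
    have hne : ∀ C' ∈ s, C' ≠ C := by
      rintro C' hC' rfl
      exact hCs hC'
    refine ⟨Function.update φ C ψ, ?_, ?_, ?_⟩
    · intro C' hC' a
      rcases Finset.mem_insert.1 hC' with rfl | hC'
      · rw [Function.update_self]
        exact hsub _ (hψS a)
      · rw [Function.update_of_ne (hne C' hC')]
        exact hφS C' hC' a
    · intro C' hC' a
      rcases Finset.mem_insert.1 hC' with rfl | hC'
      · rw [Function.update_self]
        exact hψb a
      · rw [Function.update_of_ne (hne C' hC')]
        exact hφb C' hC' a
    · intro C₁ hC₁ C₂ hC₂ h12 a a' hlt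
      rcases Finset.mem_insert.1 hC₁ with rfl | h₁
      · rcases Finset.mem_insert.1 hC₂ with rfl | h₂
        · exact absurd rfl h12
        · rw [Function.update_self, Function.update_of_ne (hne C₂ h₂)]
          exact (hcross C₂ h₂ a' a).2 hlt
      · rw [Function.update_of_ne (hne C₁ h₁)]
        rcases Finset.mem_insert.1 hC₂ with rfl | h₂
        · rw [Function.update_self]
          exact (hcross C₁ h₁ a a').1 hlt
        · rw [Function.update_of_ne (hne C₂ h₂)]
          exact hφ C₁ h₁ C₂ h₂ h12 a a' hlt

/-! ### From boats to flotillas -/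

theorem RealizesPattern.contains {H : Tournament V} {n : ℕ} {θ : Fin n ≃ V} {φ : Fin n → W}
    (hφ : T.RealizesPattern (fun i j => H.Adj (θ i) (θ j)) φ) : T.Contains H := by
  have key : ∀ i j, H.Adj (θ i) (θ j) → T.Adj (φ i) (φ j) := by
    intro i j hij
    rcases lt_trichotomy i j with h | rfl | h
    · exact (hφ i j h).1 hij
    · exact absurd hij (H.loopless _)
    · exact (hφ j i h).2 (Adj.asymm hij)
  have key' : ∀ a b, H.Adj a b → T.Adj (φ (θ.symm a)) (φ (θ.symm b)) := fun a b hab =>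
    key _ _ (by simpa using hab)
  have hinj : Function.Injective (φ ∘ θ.symm) := by
    intro a b hab
    by_contra hne
    by_cases h : H.Adj a b
    · exact Adj.ne (key' a b h) hab
    · exact Adj.ne (key' b a (adj_of_not_adj hne h)) hab.symm
  refine ⟨Set.range (φ ∘ θ.symm), Equiv.ofInjective _ hinj, fun a b => ⟨key' a b, fun h => ?_⟩⟩
  by_contra hab
  have hne : a ≠ b := by
    rintro rfl
    exact T.loopless _ h
  exact Adj.asymm h (key' b a (adj_of_not_adj hne hab))

theorem backGraph_adj_iff_of_lt (H : Tournament V) {n : ℕ} (θ : Fin n ≃ V) {p q : Fin n}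
    (h : p < q) : (H.backGraph θ).Adj (θ p) (θ q) ↔ H.Adj (θ q) (θ p) := by
  simp [backGraph, IsBackwardArc, h, h.not_gt]

theorem IsBoatAt.adj_iff {H : Tournament V} {n : ℕ} {θ : Fin n ≃ V} {i : Fin 4 → Fin n}
    (h : H.IsBoatAt θ i) {a b : Fin 4} (hab : a < b) :
    H.Adj (θ (i b)) (θ (i a)) ↔ boat.Adj b a := by
  rw [← backGraph_adj_iff_of_lt H θ (h.1 hab), h.2 a b]
  exact backGraph_adj_iff_of_lt boat boatPathOrdering hab

theorem eventually_rpow_le_two {x : ℝ} (hx : 0 < x) :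
    ∀ᶠ ε in nhdsWithin (0 : ℝ) (Set.Ioi 0), x ^ ε ≤ 2 := by
  have h : Filter.Tendsto (fun ε : ℝ => x ^ ε) (nhds 0) (nhds (x ^ (0 : ℝ))) :=
    (Real.continuous_const_rpow hx.ne').tendsto 0
  rw [Real.rpow_zero] at h
  exact nhdsWithin_le_nhds ((h.eventually (gt_mem_nhds one_lt_two)).mono fun _ => le_of_lt)

/-- The components partition the positions, so one boat per component gives a vertex for every
position. Inside a component the boat dictates the arcs; between components all arcs of H are
forward, as are those between the placed boats. Here m is the number of components. -/
theorem IsLeftFlotilla.exists_pattern {H : Tournament V} (hH : H.IsLeftFlotilla) :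
    ∃ (n m : ℕ) (θ : Fin n ≃ V), ∀ {W : Type v} {T : Tournament W} {ε c δ : ℝ} {X : Finset W},
      T.IsCritical ε X → 0 < ε → 2 * ε ≤ 1 → 0 < c → (16 / c) ^ (2 * ε) ≤ 2 →
      1 / 2 ≤ (c / 4) ^ ε → 16 / c ≤ X.card → 16 * (m + 1) * δ ≤ 1 → ∀ S : Fin n → Finset W,
      (∀ i, S i ⊆ X) → (∀ i, c * X.card ≤ (S i).card) → (∀ i j, i < j → Disjoint (S i) (S j)) →
      (∀ i j, ∀ v ∈ S i, ((T.backNbrs S i j v).card : ℝ) ≤ δ * (S j).card) →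
      ∃ φ : Fin n → W, T.RealizesPattern (fun i j => H.Adj (θ i) (θ j)) φ := by
  classical
  obtain ⟨n, θ, hθ⟩ := hH
  choose i hi hsupp using hθ
  have : Finite V := Finite.of_equiv _ θ
  let _ : Fintype (H.backGraph θ).ConnectedComponent :=
    @Fintype.ofFinite _ (Quot.finite _)
  refine ⟨n, Fintype.card (H.backGraph θ).ConnectedComponent, θ, ?_⟩
  intro W T ε c δ X hX hε hε' hc hc1 hc2 hcX hδ S hSX hSc hS hSδ
  have hcomp : ∀ C a, (H.backGraph θ).connectedComponentMk (θ (i C a)) = C := by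
    intro C a
    rw [← SimpleGraph.ConnectedComponent.mem_supp_iff, hsupp C]
    exact ⟨a, rfl⟩
  have hidx : ∀ p, ∃ a, i ((H.backGraph θ).connectedComponentMk (θ p)) a = p := by
    intro p
    have : θ p ∈ ((H.backGraph θ).connectedComponentMk (θ p)).supp := rfl
    rw [hsupp] at this
    obtain ⟨a, ha⟩ := this
    exact ⟨a, θ.injective ha⟩
  choose idx hidx using hidx
  have hmono : ∀ C, StrictMono (i C) := fun C => (hi C).1.1
  -- The vertices x, u, v all go into the set of position `i C 0`, and y into that of `i C 3`.
  set pl : (H.backGraph θ).ConnectedComponent → Fin 4 → Fin n :=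
    fun C a => if a = 3 then i C 3 else i C 0 with hpl
  have hplle : ∀ C a, pl C a ≤ i C a := by
    intro C a
    by_cases h : a = 3
    · rw [hpl]
      simp [h]
    · rw [hpl]
      simp only [h, if_false]
      exact (hmono C).monotone (Fin.zero_le a)
  have hine : ∀ C C', C ≠ C' → ∀ a a', i C a ≠ i C' a' := by
    intro C C' hCC a a' h
    apply hCC
    rw [← hcomp C a, ← hcomp C' a', h]
  have hpllt : ∀ C C', C ≠ C' → ∀ a a', i C a < i C' a' → pl C a < pl C' a' := by
    intro C C' hCC a a' hlt
    -- Moving a vertex of C to the left is harmless. On the other side, a position of another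
    -- component lying before one of the three consecutive positions of `C'` lies before all of
    -- them.
    refine (hplle C a).trans_lt ?_
    by_cases h : a' = 3
    · simpa [hpl, h] using hlt
    · simp only [hpl, h, if_false]
      have e1 := (hi C').2.1
      have e2 := (hi C').2.2
      have n0 : (i C a : ℕ) ≠ i C' 0 := fun h => hine C C' hCC a 0 (Fin.ext h)
      have n1 : (i C a : ℕ) ≠ i C' 1 := fun h => hine C C' hCC a 1 (Fin.ext h)
      have n2 : (i C a : ℕ) ≠ i C' 2 := fun h => hine C C' hCC a 2 (Fin.ext h)
      have hle : i C' a' ≤ i C' 2 := (hmono C').monotone (by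
        have : (a' : ℕ) ≠ 3 := fun e => h (Fin.ext e)
        have := a'.2
        exact Fin.le_def.2 (by change (a' : ℕ) ≤ 2; omega))
      rw [Fin.lt_def] at hlt ⊢
      rw [Fin.le_def] at hle
      omega
  obtain ⟨φ, hφS, hφb, hφ⟩ := hX.exists_boats hε hε' hc hc1 hc2 hcX hSX hSc
    (fun i j hij => (lt_or_gt_of_ne hij).elim (hS i j) fun h => (hS j i h).symm) hSδ pl
    (fun C => rfl) (fun C => rfl) (fun C => hmono C (by decide))
    Finset.univ hδ
  refine ⟨fun p => φ ((H.backGraph θ).connectedComponentMk (θ p)) (idx p), fun p q hpq => ?_⟩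
  have hp := hidx p
  have hq := hidx q
  by_cases hCC : (H.backGraph θ).connectedComponentMk (θ p) =
      (H.backGraph θ).connectedComponentMk (θ q)
  · rw [← hCC] at hq
    simp only [← hCC]
    set C := (H.backGraph θ).connectedComponentMk (θ p) with hC
    have hab : idx p < idx q := by
      rw [← (hmono C).lt_iff_lt, hp, hq]
      exact hpq
    have h1 := (hi C).1.adj_iff hab
    rw [hp, hq] at h1
    refine ⟨fun hD => hφb C (Finset.mem_univ _) _ _ (adj_of_not_adj hab.ne' fun h => ?_),
      fun hD => hφb C (Finset.mem_univ _) _ _ (h1.1 (adj_of_not_adj ?_ hD))⟩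
    · exact Adj.asymm hD (h1.2 h)
    · exact fun e => hpq.ne (θ.injective e)
  · have hnadj : ¬ H.Adj (θ q) (θ p) := fun h => hCC
      (SimpleGraph.ConnectedComponent.connectedComponentMk_eq_of_adj
        ((backGraph_adj_iff_of_lt H θ hpq).2 h))
    have hadj : H.Adj (θ p) (θ q) := adj_of_not_adj (fun e => hpq.ne' (θ.injective e)) hnadj
    refine ⟨fun _ => hφ _ (Finset.mem_univ _) _ (Finset.mem_univ _) hCC _ _
      (hpllt _ _ hCC _ _ (by rwa [hp, hq])), fun h => absurd hadj h⟩

/-- A least violating set would be critical, and then H would embed. The constants δ, c, N depend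
only on H and are fixed before ε, which is chosen small enough for them. -/
theorem IsLeftFlotilla.satisfiesEHC {H : Tournament V} (hH : H.IsLeftFlotilla) :
    SatisfiesEHC.{u, v} H := by
  classical
  obtain ⟨n, m, θ, hpat⟩ := IsLeftFlotilla.exists_pattern.{u, v} hH
  have hδ : (0 : ℝ) < 1 / (16 * (m + 1)) := by positivity
  obtain ⟨c, hc, N, hseq⟩ := exists_smooth_sequence.{v} hδ n n
  have hM : 0 < max N (16 / c) := lt_max_of_lt_right (by positivity)
  have hev := (eventually_rpow_le_two (show 0 < (16 / c) ^ 2 by positivity)).and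
    ((eventually_rpow_le_two (show 0 < (c / 4)⁻¹ by positivity)).and
      ((eventually_rpow_le_two hM).and (Ioo_mem_nhdsGT (show (0 : ℝ) < 1 / 2 by norm_num))))
  obtain ⟨ε, hε1, hε2, hε3, hε0, hε4⟩ := hev.exists
  refine ⟨ε, hε0, fun W _ T hT => ?_⟩
  have key : ∀ X : Finset W, (X.card : ℝ) ^ ε ≤ T.tr X := by
    intro X
    induction X using Finset.strongInduction with
    | H X ih =>
      by_contra hcon
      have hX : T.IsCritical ε X := ⟨not_le.1 hcon, ih⟩
      have hXM := hX.le_card hε0 (by linarith) hε3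
      obtain ⟨S, hSX, hSc, hS, hSδ⟩ := hseq T (fun i j => H.Adj (θ i) (θ j)) X
        ((le_max_left _ _).trans hXM) fun ⟨φ, hφ⟩ => hT hφ.contains
      obtain ⟨φ, hφ⟩ := hpat hX hε0 (by linarith) hc
        (by
          rwa [Real.rpow_mul (by positivity), Real.rpow_two])
        (by
          rw [Real.inv_rpow (by positivity)] at hε2
          have h0 : 0 < (c / 4) ^ ε := Real.rpow_pos_of_pos (by positivity) _
          rw [inv_le_comm₀ h0 two_pos] at hε2
          rwa [one_div])
        ((le_max_right _ _).trans hXM)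
        (by field_simp; exact le_rfl) S hSX hSc hS hSδ
      exact hT hφ.contains
  obtain ⟨Z, -, hZ, hZc⟩ := T.exists_transOn_card_eq_tr Finset.univ
  refine ⟨Z, hZ.isTransitive, ?_⟩
  rw [hZc, ← Finset.card_univ]
  exact key Finset.univ

/-! ### Right flotillas by reversal -/

/-- The tournament with all arcs reversed. -/
def reverse (T : Tournament W) : Tournament W where
  Adj a b := T.Adj b a
  loopless := T.loopless
  exactly_one a b hab := T.exactly_one b a hab.symm

theorem Contains.of_reverse {H : Tournament V} (h : T.reverse.Contains H.reverse) :
    T.Contains H := by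
  obtain ⟨X, e, he⟩ := h
  exact ⟨X, e, fun a b => he b a⟩

theorem isTransitive_induce_of_reverse {X : Set W} (h : (T.reverse.induce X).IsTransitive) :
    (T.induce X).IsTransitive := by
  intro a ha
  refine h a ?_
  have : (T.reverse.induce X).Adj = Function.swap (T.induce X).Adj := rfl
  rw [this, Relation.transGen_swap]
  exact ha

theorem SatisfiesEHC.of_reverse {H : Tournament V} (h : SatisfiesEHC.{u, v} H.reverse) :
    SatisfiesEHC.{u, v} H := by
  obtain ⟨ε, hε, h⟩ := h
  refine ⟨ε, hε, fun W _ T hT => ?_⟩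
  obtain ⟨X, hX, hXc⟩ := h W T.reverse fun hc => hT hc.of_reverse
  exact ⟨X, isTransitive_induce_of_reverse hX, hXc⟩

/-- Reversing both the arcs and the ordering keeps every backward arc backward. -/
theorem backGraph_reverse (H : Tournament V) {n : ℕ} (θ : Fin n ≃ V) :
    H.reverse.backGraph (Fin.revPerm.trans θ) = H.backGraph θ := by
  ext a b
  simp only [backGraph, IsBackwardArc, reverse, Equiv.symm_trans_apply, Fin.revPerm_symm,
    Fin.revPerm_apply, Fin.rev_lt_rev]
  exact or_comm

/-- Exchanging x with y and u with v fixes the edge xy and swaps yu with vx, so reversal turns right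
boats into left boats. -/
theorem boat_backGraph_adj_rev (a b : Fin 4) :
    (boat.backGraph boatPathOrdering).Adj a.rev b.rev ↔
      (boat.backGraph boatPathOrdering).Adj a b := by
  simp only [backGraph, IsBackwardArc, boat, boatPathOrdering, Equiv.refl_symm, Equiv.refl_apply]
  revert a b
  decide

theorem IsRightFlotilla.isLeftFlotilla_reverse {H : Tournament V} (hH : H.IsRightFlotilla) :
    H.reverse.IsLeftFlotilla := by
  obtain ⟨n, θ, hθ⟩ := hH
  refine ⟨n, Fin.revPerm.trans θ, ?_⟩
  rw [backGraph_reverse]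
  intro C
  obtain ⟨i, ⟨⟨hmono, hi⟩, h2, h3⟩, hC⟩ := hθ C
  refine ⟨fun k => (i k.rev).rev, ⟨⟨?_, ?_⟩, ?_, ?_⟩, ?_⟩
  · intro a b hab
    exact Fin.rev_lt_rev.2 (hmono (Fin.rev_lt_rev.2 hab))
  · intro a b
    rw [backGraph_reverse, ← boat_backGraph_adj_rev, ← hi]
    simp
  · have := (i 2).2
    have := (i 3).2
    change n - (i 2 + 1 : ℕ) = n - (i 3 + 1 : ℕ) + 1
    omega
  · have := (i 1).2
    have := (i 2).2
    change n - (i 1 + 1 : ℕ) = n - (i 2 + 1 : ℕ) + 1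
    omega
  · rw [hC]
    ext w
    constructor
    · rintro ⟨k, rfl⟩
      exact ⟨k.rev, by simp⟩
    · rintro ⟨k, rfl⟩
      exact ⟨k.rev, by simp⟩

end Tournament

theorem mainTheorem3 {V : Type u} (H : Tournament V) :
    (H.IsLeftFlotilla → Tournament.SatisfiesEHC.{u, v} H) ∧
      (H.IsRightFlotilla → Tournament.SatisfiesEHC.{u, v} H) :=
  ⟨fun h => h.satisfiesEHC, fun h => h.isLeftFlotilla_reverse.satisfiesEHC.of_reverse⟩
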